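/- Let $n,m\ge 0$, let $M\le G\le S_n$ be permutation groups, let $\psi\in\mathrm{Hom}(M,S_m)$, and suppose that $\varphi\in\mathrm{Hom}(G,S_m)$ extends $\psi$. For $\lambda\in S_m$ let $\varphi^\lambda\in\mathrm{Hom}(G,S_m)$ be defined by $\varphi^\lambda(g)=\lambda^{-1}\varphi(g)\lambda$. A homomorphism $\chi\in\mathrm{Hom}(G,S_m)$ is called an extension of $\psi$ equivalent to $\varphi$ if $\chi|_M=\psi$ and $\chi=\varphi^\lambda$ for some $\lambda\in S_m$. Write $C_{S_m}(\cdot)$ for the centralizer in $S_m$. Then the following hold. 1. The extensions of $\psi$ equivalent to $\varphi$ are exactly the homomorphisms $\varphi^\lambda$ with $\lambda\in C_{S_m}(\psi(M))$. Moreover $C_{S_m}(\varphi(G))\le C_{S_m}(\psi(M))$, and the number of extensions of $\psi$ equivalent to $\varphi$ is the index $|C_{S_m}(\psi(M)):C_{S_m}(\varphi(G))|$. 2. The class of extensions of $\psi$ equivalent to $\varphi$ can be efficiently enumerated. That is, there are one algorithm (a program for a random access machine with logarithmic cost) and one polynomial $p(n,m)$ such that the following holds for all $n,m,M,G,\psi,\varphi$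 as above. The input consists of $n$, $m$, a list of at most $2n$ generators of $M$ with the values of $\psi$ on them, and a list of at most $2n$ generators of $G$ with the values of $\varphi$ on them, each permutation being written as the list of its values. On this input the algorithm lists all extensions of $\psi$ equivalent to $\varphi$, each exactly once and each represented by its values on the given generators of $G$, and then halts. The time before the first output, the time between any two consecutive outputs, and the time from the last output to the halt are each at most $p(n,m)$. -/

import Mathlib

namespace HomExtEnum

open Equiv

/-! ### A random access machine with logarithmic cost

The machine has registers (named by constants of the program) and an indirectly addressed memory,
both holding natural numbers of unbounded size.  Every elementary operation is charged one unit
plus the bit lengths of all the numbers and addresses that it handles.  Control flow is structured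
(sequence, branch, loop). -/

/-- Elementary instructions. The letters `r`, `a`, `b` are names of registers. -/
inductive Instr where
  /-- `r := c` for a constant `c` -/
  | const (r c : ℕ)
  /-- `r := a` -/
  | copy (r a : ℕ)
  /-- `r := a + b` -/
  | add (r a b : ℕ)
  /-- `r := a - b`, or `0` if `a < b` -/
  | sub (r a b : ℕ)
  /-- `r := a * b` -/
  | mul (r a b : ℕ)
  /-- `r := mem[a]` -/
  | load (r a : ℕ)
  /-- `mem[a] := b` -/
  | store (a b : ℕ)
  /-- append the content of `a` to the output item under construction -/
  | write (a : ℕ)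
  /-- deliver the output item under construction, and start a new, empty one -/
  | deliver

/-- Programs. -/
inductive Prog where
  /-- do nothing -/
  | skip
  /-- execute one instruction -/
  | instr (i : Instr)
  /-- first `p`, then `q` -/
  | seq (p q : Prog)
  /-- if register `r` is nonzero then `p` else `q` -/
  | branch (r : ℕ) (p q : Prog)
  /-- as long as register `r` is nonzero, repeat `p` -/
  | loop (r : ℕ) (p : Prog)

/-- Configurations of the machine, with the time elapsed so far and the output delivered so far. -/
structure Config where
  /-- contents of the registers -/
  reg : ℕ → ℕ
  /-- contents of the memory -/
  mem : ℕ → ℕ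
  /-- total cost of what has been executed so far -/
  clock : ℕ
  /-- the output item under construction -/
  buf : List ℕ
  /-- the delivered items in order of delivery, each with the time of its delivery -/
  out : List (List ℕ × ℕ)

/-- The logarithmic cost of an instruction; `Nat.size x` is the bit length of `x`. -/
def Instr.cost (s : Config) : Instr → ℕ
  | .const _ c => 1 + c.size
  | .copy _ a => 1 + (s.reg a).size
  | .add _ a b => 1 + (s.reg a).size + (s.reg b).size
  | .sub _ a b => 1 + (s.reg a).size + (s.reg b).size
  | .mul _ a b => 1 + (s.reg a).size + (s.reg b).size
  | .load _ a => 1 + (s.reg a).size + (s.mem (s.reg a)).size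
  | .store a b => 1 + (s.reg a).size + (s.reg b).size
  | .write a => 1 + (s.reg a).size
  | .deliver => 1

/-- Let `t` units of time pass. -/
def Config.tick (s : Config) (t : ℕ) : Config :=
  { s with clock := s.clock + t }

/-- Assign the value `v` to register `r`. -/
def Config.setReg (s : Config) (r v : ℕ) : Config :=
  { s with reg := Function.update s.reg r v }

/-- The effect of an instruction, apart from the passing of time. -/
def Instr.effect (s : Config) : Instr → Config
  | .const r c => s.setReg r c
  | .copy r a => s.setReg r (s.reg a)
  | .add r a b => s.setReg r (s.reg a + s.reg b)
  | .sub r a b => s.setReg r (s.reg a - s.reg b)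
  | .mul r a b => s.setReg r (s.reg a * s.reg b)
  | .load r a => s.setReg r (s.mem (s.reg a))
  | .store a b => { s with mem := Function.update s.mem (s.reg a) (s.reg b) }
  | .write a => { s with buf := s.buf ++ [s.reg a] }
  | .deliver => { s with buf := [], out := s.out ++ [(s.buf, s.clock)] }

/-- `Exec p s s'`: started in the configuration `s`, the program `p` halts, in the
configuration `s'`. -/
inductive Exec : Prog → Config → Config → Prop where
  | skip (s : Config) : Exec .skip s s
  | instr (i : Instr) (s : Config) : Exec (.instr i) s (i.effect (s.tick (i.cost s)))
  | seq {p q : Prog} {s s' s'' : Config} :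
      Exec p s s' → Exec q s' s'' → Exec (.seq p q) s s''
  | branch_true {r : ℕ} {p q : Prog} {s s' : Config} :
      s.reg r ≠ 0 → Exec p (s.tick (1 + (s.reg r).size)) s' → Exec (.branch r p q) s s'
  | branch_false {r : ℕ} {p q : Prog} {s s' : Config} :
      s.reg r = 0 → Exec q (s.tick 1) s' → Exec (.branch r p q) s s'
  | loop_done {r : ℕ} {p : Prog} {s : Config} :
      s.reg r = 0 → Exec (.loop r p) s (s.tick 1)
  | loop_again {r : ℕ} {p : Prog} {s s' s'' : Config} :
      s.reg r ≠ 0 → Exec p (s.tick (1 + (s.reg r).size)) s' →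
        Exec (.loop r p) s' s'' → Exec (.loop r p) s s''

/-- The initial configuration: the input stands in the memory cells `0, 1, 2, …`, and everything
else is zero or empty. -/
def Config.init (input : List ℕ) : Config where
  reg := fun _ => 0
  mem := fun i => input.getD i 0
  clock := 0
  buf := []
  out := []

/-- On the given input, the program `P` halts after having delivered exactly the list `items`, in
this order, at marginal cost at most `t`: at most `t` units of time pass between the start and the
first delivery, between any two consecutive deliveries, and between the last delivery and the
halt. -/
def EnumeratesAtMarginalCost (P : Prog) (input : List ℕ) (items : List (List ℕ)) (t : ℕ) : Prop :=
  ∃ s : Config, Exec P (Config.init input) s ∧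
    s.out.map Prod.fst = items ∧ s.buf = [] ∧
    List.IsChain (fun t₁ t₂ : ℕ => t₂ ≤ t₁ + t) (0 :: (s.out.map Prod.snd ++ [s.clock]))

/-! ### Extensions of permutation actions -/

/-- `φ` extends `ψ`. -/
def Extends {n m : ℕ} {M G : Subgroup (Perm (Fin n))} (h : M ≤ G)
    (ψ : M →* Perm (Fin m)) (φ : G →* Perm (Fin m)) : Prop :=
  ∀ x : M, φ (Subgroup.inclusion h x) = ψ x

/-- The conjugate action `g ↦ c⁻¹ * φ g * c`. -/
def conjAction {n m : ℕ} {G : Subgroup (Perm (Fin n))} (φ : G →* Perm (Fin m))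
    (c : Perm (Fin m)) : G →* Perm (Fin m) where
  toFun g := c⁻¹ * φ g * c
  map_one' := by simp
  map_mul' x y := by simp [mul_assoc]

/-- Equivalent permutation actions. -/
def EquivalentActions {n m : ℕ} {G : Subgroup (Perm (Fin n))}
    (φ₁ φ₂ : G →* Perm (Fin m)) : Prop :=
  ∃ c : Perm (Fin m), φ₁ = conjAction φ₂ c

/-- `φ₁` and `φ₂` are equivalent extensions of `ψ`. -/
def EquivalentExtensions {n m : ℕ} {M G : Subgroup (Perm (Fin n))} (h : M ≤ G)
    (ψ : M →* Perm (Fin m)) (φ₁ φ₂ : G →* Perm (Fin m)) : Prop :=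
  Extends h ψ φ₁ ∧ Extends h ψ φ₂ ∧ EquivalentActions φ₁ φ₂

/-! ### Representation of permutation groups and homomorphisms by lists of numbers -/

/-- A permutation is represented by the list of its values. -/
def permCode {n : ℕ} (σ : Perm (Fin n)) : List ℕ :=
  List.ofFn fun i => (σ i : ℕ)

/-- A permutation group is represented by a list of generators. -/
def groupCode {n : ℕ} {G : Subgroup (Perm (Fin n))} (B : List G) : List ℕ :=
  B.flatMap fun b => permCode (b : Perm (Fin n))

/-- A homomorphism is represented by its values on a list of generators. -/
def homCode {n m : ℕ} {G : Subgroup (Perm (Fin n))} (B : List G) (φ : G →* Perm (Fin m)) :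
    List ℕ :=
  B.flatMap fun b => permCode (φ b)

/-- The list `B` generates `G` and has at most `2 * n` entries, `n` being the degree of `G`. -/
def IsGenList {n : ℕ} {G : Subgroup (Perm (Fin n))} (B : List G) : Prop :=
  Subgroup.closure {x : G | x ∈ B} = ⊤ ∧ B.length ≤ 2 * n

/-- The input: the degrees `n` and `m`, the numbers of generators, the generators `A` of `M` with
the values of `ψ` on them, and the generators `B` of `G` with the values of `φ` on them. -/
def inputCode {n m : ℕ} {M G : Subgroup (Perm (Fin n))} (A : List M) (B : List G)
    (ψ : M →* Perm (Fin m)) (φ : G →* Perm (Fin m)) : List ℕ :=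
  [n, m, A.length, B.length] ++ groupCode A ++ homCode A ψ ++ groupCode B ++ homCode B φ

end HomExtEnum

namespace HomExtEnum

open Equiv

/-! ### A structured language on top of the machine -/

/-! Let K and C be the centralizers of ψ(M) and φ(G); then C ≤ K. Conjugating φ by a permutation
keeps ψ on M exactly when the permutation lies in K, and the conjugates by a and b agree exactly
when a * b⁻¹ lies in C. So the class corresponds to the right cosets of C in K. This gives the index
formula and reduces the enumeration to listing one element per coset.

The representative of a coset is its element with the lexicographically least sequence of values
(`Canon`), and these are found by depth-first search on prefixes. By `canon_step`, a prefix of a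
canonical element of K can be continued by y iff some element of K has the longer prefix and y is
least in its orbit under the pointwise stabilizer in C of the previous values.

Both conditions ask whether a permutation through prescribed pairs of points commutes with given
generators. By `partialInj_closure_iff` it is enough to close the pairs under the diagonal action
and to check that the result is an injective partial function. Such a function extends by sending
the end of every maximal chain back to its beginning; no choice is involved, so the extension still
commutes (`exists_perm_of_partialInj`).

The test is exact, so the search has no dead ends: every node that it enters has an output below it.
The depth is m, a node has at most m values to try, and each step takes polynomial time. Hence both
the wait for the first output of a subtree and the time between its last output and its end are
polynomial (`search_values`, `searchSpec`).

To run this on the machine, programs are written in a small structured language `Stm` with Hoare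
triples `Tri`. A triple bounds all numbers by V and the time by an expression in V, which for a
fixed program is a polynomial. -/

theorem size_le_self (x : ℕ) : x.size ≤ x :=
  Nat.size_le.2 Nat.lt_two_pow_self

/-- Arithmetic expressions over the visible registers and the memory. -/
inductive Expr where
  | reg (r : ℕ)
  | const (c : ℕ)
  | add (x y : Expr)
  | sub (x y : Expr)
  | mul (x y : Expr)
  | load (x : Expr)

/-- States of the structured language. The visible register `r` is the machine register `2 * r`;
the odd machine registers are scratch. -/
structure St where
  reg : ℕ → ℕ
  mem : ℕ → ℕ
  buf : List ℕ

/-- Assign a visible register. -/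
def St.set (s : St) (r v : ℕ) : St := { s with reg := Function.update s.reg r v }

/-- Assign a memory cell. -/
def St.put (s : St) (a v : ℕ) : St := { s with mem := Function.update s.mem a v }

@[simp] theorem St.set_reg (s : St) (r v q : ℕ) :
    (s.set r v).reg q = if q = r then v else s.reg q := by
  simp [St.set, Function.update_apply]

@[simp] theorem St.set_mem (s : St) (r v : ℕ) : (s.set r v).mem = s.mem := rfl

@[simp] theorem St.set_buf (s : St) (r v : ℕ) : (s.set r v).buf = s.buf := rfl

@[simp] theorem St.put_reg (s : St) (a v : ℕ) : (s.put a v).reg = s.reg := rfl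

@[simp] theorem St.put_mem (s : St) (a v q : ℕ) :
    (s.put a v).mem q = if q = a then v else s.mem q := by
  simp [St.put, Function.update_apply]

/-- The value of an expression. -/
@[simp] def Expr.val (s : St) : Expr → ℕ
  | .reg r => s.reg r
  | .const c => c
  | .add x y => x.val s + y.val s
  | .sub x y => x.val s - y.val s
  | .mul x y => x.val s * y.val s
  | .load x => s.mem (x.val s)

/-- A bound for the value of an expression when registers and memory hold numbers up to `V`. -/
def Expr.bound (V : ℕ) : Expr → ℕ
  | .reg _ => V
  | .const c => c
  | .add x y => x.bound V + y.bound V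
  | .sub x _ => x.bound V
  | .mul x y => x.bound V * y.bound V
  | .load _ => V

/-- A bound for the time that the evaluation of an expression takes. -/
def Expr.time (V : ℕ) : Expr → ℕ
  | .reg _ => 1 + V
  | .const c => 1 + c
  | .add x y => x.time V + y.time V + (1 + x.bound V + y.bound V)
  | .sub x y => x.time V + y.time V + (1 + x.bound V + y.bound V)
  | .mul x y => x.time V + y.time V + (1 + x.bound V + y.bound V)
  | .load x => x.time V + (1 + x.bound V + V)

/-- Code that puts the value of an expression into the scratch register number `b`. -/
def Expr.code : Expr → ℕ → Prog
  | .reg r, b => .instr (.copy (2 * b + 1) (2 * r))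
  | .const c, b => .instr (.const (2 * b + 1) c)
  | .add x y, b => .seq (x.code b) (.seq (y.code (b + 1))
      (.instr (.add (2 * b + 1) (2 * b + 1) (2 * (b + 1) + 1))))
  | .sub x y, b => .seq (x.code b) (.seq (y.code (b + 1))
      (.instr (.sub (2 * b + 1) (2 * b + 1) (2 * (b + 1) + 1))))
  | .mul x y, b => .seq (x.code b) (.seq (y.code (b + 1))
      (.instr (.mul (2 * b + 1) (2 * b + 1) (2 * (b + 1) + 1))))
  | .load x, b => .seq (x.code b) (.instr (.load (2 * b + 1) (2 * b + 1)))

/-- The machine configuration `c` represents the state `s`. -/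
structure Rel (c : Config) (s : St) : Prop where
  reg : ∀ r, c.reg (2 * r) = s.reg r
  mem : c.mem = s.mem
  buf : c.buf = s.buf

/-- All the numbers in the state are at most `V`. -/
structure St.Bdd (V : ℕ) (s : St) : Prop where
  reg : ∀ r, s.reg r ≤ V
  mem : ∀ a, s.mem a ≤ V

theorem St.Bdd.set {V : ℕ} {s : St} (h : s.Bdd V) {r v : ℕ} (hv : v ≤ V) : (s.set r v).Bdd V where
  reg q := by
    rw [St.set_reg]
    split_ifs
    exacts [hv, h.reg q]
  mem := h.mem

theorem St.Bdd.put {V : ℕ} {s : St} (h : s.Bdd V) {a v : ℕ} (hv : v ≤ V) : (s.put a v).Bdd V where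
  reg := h.reg
  mem q := by
    rw [St.put_mem]
    split_ifs
    exacts [hv, h.mem q]

theorem Expr.val_le_bound {V : ℕ} {s : St} (h : s.Bdd V) (e : Expr) : e.val s ≤ e.bound V := by
  induction e with
  | reg r => exact h.reg r
  | const c => exact le_rfl
  | add x y hx hy => exact Nat.add_le_add hx hy
  | sub x y hx hy => exact (Nat.sub_le _ _).trans hx
  | mul x y hx hy => exact Nat.mul_le_mul hx hy
  | load x hx => exact h.mem _

/-- The effect of code for an expression `e` with result in the scratch register number `b`. -/
structure Expr.Post (e : Expr) (V b : ℕ) (s : St) (c c' : Config) : Prop where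
  res : c'.reg (2 * b + 1) = e.val s
  rel : Rel c' s
  scratch : ∀ i < b, c'.reg (2 * i + 1) = c.reg (2 * i + 1)
  out : c'.out = c.out
  le_clock : c.clock ≤ c'.clock
  clock_le : c'.clock ≤ c.clock + e.time V

theorem Rel.setReg_odd {c : Config} {s : St} (h : Rel c s) (b v t : ℕ) :
    Rel ((c.tick t).setReg (2 * b + 1) v) s where
  reg r := by
    simp only [Config.setReg, Config.tick]
    rw [Function.update_of_ne (by omega)]
    exact h.reg r
  mem := h.mem
  buf := h.buf

theorem Config.tick_reg (c : Config) (t : ℕ) : (c.tick t).reg = c.reg := rfl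

theorem Rel.tick {c : Config} {s : St} (h : Rel c s) (t : ℕ) : Rel (c.tick t) s :=
  ⟨h.reg, h.mem, h.buf⟩

theorem Rel.setReg_even {c : Config} {s : St} (h : Rel c s) (r v t : ℕ) :
    Rel ((c.tick t).setReg (2 * r) v) (s.set r v) where
  reg q := by
    simp only [Config.setReg, Config.tick, St.set_reg, Function.update_apply]
    have := h.reg q
    split_ifs <;> first | rfl | omega
  mem := h.mem
  buf := h.buf

/-- The first operand waits in scratch register `b` while the second is evaluated from scratch
register `b + 1` on, which leaves the lower ones alone. Bit lengths are estimated by the numbers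
themselves, which is enough for a polynomial bound. -/
theorem Expr.exec_binary {V : ℕ} {s : St} (hs : s.Bdd V) {x y e : Expr}
    (hx : ∀ b c, Rel c s → ∃ c', Exec (x.code b) c c' ∧ x.Post V b s c c')
    (hy : ∀ b c, Rel c s → ∃ c', Exec (y.code b) c c' ∧ y.Post V b s c c')
    (b : ℕ) (i : Instr) (v : ℕ) (hv : e.val s = v)
    (ht : e.time V = x.time V + y.time V + (1 + x.bound V + y.bound V))
    (heff : ∀ c : Config, c.reg (2 * b + 1) = x.val s → c.reg (2 * (b + 1) + 1) = y.val s →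
      i.effect c = c.setReg (2 * b + 1) v)
    (hcost : ∀ c : Config, c.reg (2 * b + 1) = x.val s → c.reg (2 * (b + 1) + 1) = y.val s →
      i.cost c = 1 + (x.val s).size + (y.val s).size)
    (c : Config) (hc : Rel c s) :
    ∃ c', Exec (.seq (x.code b) (.seq (y.code (b + 1)) (.instr i))) c c' ∧ e.Post V b s c c' := by
  obtain ⟨c₁, e₁, p₁⟩ := hx b c hc
  obtain ⟨c₂, e₂, p₂⟩ := hy (b + 1) c₁ p₁.rel
  have h1 : c₂.reg (2 * b + 1) = x.val s := (p₂.scratch b (by omega)).trans p₁.res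
  refine ⟨_, .seq e₁ (.seq e₂ (.instr i c₂)), ?_⟩
  rw [heff _ (by exact h1) (by exact p₂.res), hcost _ h1 p₂.res]
  refine ⟨?_, p₂.rel.setReg_odd _ _ _, ?_, ?_, ?_, ?_⟩
  · simp [Config.setReg, hv]
  · intro j hj
    simp only [Config.setReg, Config.tick]
    rw [Function.update_of_ne (by omega), p₂.scratch j (by omega), p₁.scratch j hj]
  · exact p₂.out.trans p₁.out
  · have := p₁.le_clock
    have := p₂.le_clock
    simp only [Config.setReg, Config.tick]
    omega
  · have := p₁.clock_le
    have := p₂.clock_le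
    have := size_le_self (x.val s)
    have := size_le_self (y.val s)
    have := x.val_le_bound hs
    have := y.val_le_bound hs
    simp only [Config.setReg, Config.tick]
    omega

theorem Expr.exec {V : ℕ} {s : St} (hs : s.Bdd V) (e : Expr) :
    ∀ b c, Rel c s → ∃ c', Exec (e.code b) c c' ∧ e.Post V b s c c' := by
  induction e with
  | reg r =>
    intro b c hc
    refine ⟨_, .instr _ _, ?_, hc.setReg_odd _ _ _, ?_, rfl, ?_, ?_⟩
    · simp [Instr.effect, Config.setReg, Config.tick, hc.reg]
    · intro i hi
      simp only [Instr.effect, Config.setReg, Config.tick]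
      rw [Function.update_of_ne (by omega)]
    · simp [Instr.effect, Config.setReg, Config.tick]
    · have := size_le_self (s.reg r)
      have := hs.reg r
      simp only [Instr.effect, Instr.cost, Config.setReg, Config.tick, hc.reg, Expr.time]
      omega
  | const k =>
    intro b c hc
    refine ⟨_, .instr _ _, ?_, hc.setReg_odd _ _ _, ?_, rfl, ?_, ?_⟩
    · simp [Instr.effect, Config.setReg, Config.tick]
    · intro i hi
      simp only [Instr.effect, Config.setReg, Config.tick]
      rw [Function.update_of_ne (by omega)]
    · simp [Instr.effect, Config.setReg, Config.tick]
    · have := size_le_self k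
      simp only [Instr.effect, Instr.cost, Config.setReg, Config.tick, Expr.time]
      omega
  | add x y hx hy =>
    intro b
    exact Expr.exec_binary hs hx hy b _ (x.val s + y.val s) rfl rfl
      (fun c h1 h2 => by simp only [Instr.effect, h1, h2])
      (fun c h1 h2 => by simp only [Instr.cost, h1, h2])
  | sub x y hx hy =>
    intro b
    exact Expr.exec_binary hs hx hy b _ (x.val s - y.val s) rfl rfl
      (fun c h1 h2 => by simp only [Instr.effect, h1, h2])
      (fun c h1 h2 => by simp only [Instr.cost, h1, h2])
  | mul x y hx hy =>
    intro b
    exact Expr.exec_binary hs hx hy b _ (x.val s * y.val s) rfl rfl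
      (fun c h1 h2 => by simp only [Instr.effect, h1, h2])
      (fun c h1 h2 => by simp only [Instr.cost, h1, h2])
  | load x hx =>
    intro b c hc
    obtain ⟨c₁, e₁, p₁⟩ := hx b c hc
    refine ⟨_, .seq e₁ (.instr _ _), ?_, p₁.rel.setReg_odd _ _ _, ?_, p₁.out, ?_, ?_⟩
    · simp [Instr.effect, Config.setReg, Config.tick, p₁.res, p₁.rel.mem]
    · intro i hi
      simp only [Instr.effect, Config.setReg, Config.tick]
      rw [Function.update_of_ne (by omega), p₁.scratch i hi]
    · have := p₁.le_clock
      simp only [Instr.effect, Config.setReg, Config.tick]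
      omega
    · have := p₁.clock_le
      have := size_le_self (x.val s)
      have := x.val_le_bound hs
      have := size_le_self (s.mem (x.val s))
      have := hs.mem (x.val s)
      simp only [Instr.effect, Instr.cost, Config.setReg, Config.tick, p₁.res, p₁.rel.mem,
        Expr.time]
      omega

/-- Structured statements. -/
inductive Stm where
  | skip
  | set (r : ℕ) (e : Expr)
  | store (x y : Expr)
  | write (e : Expr)
  | seq (p q : Stm)
  | ite (e : Expr) (p q : Stm)
  /-- run `p` for all `i` from `0` to the content of register `n` (exclusive) -/
  | loop (i n : ℕ) (p : Stm)

/-- Machine code for a statement. -/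
def Stm.code : Stm → Prog
  | .skip => .skip
  | .set r e => .seq (e.code 1) (.instr (.copy (2 * r) 3))
  | .store x y => .seq (x.code 1) (.seq (y.code 2) (.instr (.store 3 5)))
  | .write e => .seq (e.code 1) (.instr (.write 3))
  | .seq p q => .seq p.code q.code
  | .ite e p q => .seq (e.code 1) (.branch 3 p.code q.code)
  | .loop i n p => .seq (.instr (.const (2 * i) 0)) (.seq (.instr (.sub 1 (2 * n) (2 * i)))
      (.loop 1 (.seq p.code (.seq (.instr (.const 3 1)) (.seq (.instr (.add (2 * i) (2 * i) 3))
        (.instr (.sub 1 (2 * n) (2 * i))))))))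

/-- A bound for the running time of a statement. -/
def Stm.time (V : ℕ) : Stm → ℕ
  | .skip => 0
  | .set _ e => e.time V + (1 + e.bound V)
  | .store x y => x.time V + y.time V + (1 + x.bound V + y.bound V)
  | .write e => e.time V + (1 + e.bound V)
  | .seq p q => p.time V + q.time V
  | .ite e p q => e.time V + (1 + e.bound V) + (p.time V + q.time V)
  | .loop _ _ p => V * (p.time V + (4 * V + 10)) + (2 * V + 10)

/-- The visible registers that a statement may change. -/
@[simp] def Stm.writes : Stm → List ℕ
  | .skip => []
  | .set r _ => [r]
  | .store _ _ => []
  | .write _ => []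
  | .seq p q => p.writes ++ q.writes
  | .ite _ p q => p.writes ++ q.writes
  | .loop i _ p => i :: p.writes

/-- Total correctness of a statement started in the state `s`, with the time bound. -/
def Tri (V : ℕ) (p : Stm) (s : St) (Q : St → Prop) : Prop :=
  s.Bdd V → ∀ c, Rel c s → ∃ c' s', Exec p.code c c' ∧ Rel c' s' ∧ s'.Bdd V ∧ c'.out = c.out ∧
    c.clock ≤ c'.clock ∧ c'.clock ≤ c.clock + p.time V ∧
    (∀ r ∉ p.writes, s'.reg r = s.reg r) ∧ Q s'

/-- This rule also supplies the value bound and the preservation of unwritten registers, so that no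
postcondition has to list them. -/
theorem Tri.imp {V : ℕ} {p : Stm} {s : St} {Q Q' : St → Prop} (h : Tri V p s Q)
    (hQ : ∀ s', s'.Bdd V → (∀ r ∉ p.writes, s'.reg r = s.reg r) → Q s' → Q' s') :
    Tri V p s Q' := by
  intro hs c hc
  obtain ⟨c', s', h1, h2, h3, h4, h5, h6, h7, h8⟩ := h hs c hc
  exact ⟨c', s', h1, h2, h3, h4, h5, h6, h7, hQ s' h3 h7 h8⟩

theorem Tri.of_bdd {V : ℕ} {p : Stm} {s : St} {Q : St → Prop} (h : s.Bdd V → Tri V p s Q) :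
    Tri V p s Q := fun hs => h hs hs

theorem Tri.skip {V : ℕ} {s : St} {Q : St → Prop} (h : Q s) : Tri V .skip s Q := by
  intro hs c hc
  exact ⟨c, s, .skip c, hc, hs, rfl, le_rfl, by simp, fun _ _ => rfl, h⟩

theorem Tri.set {V : ℕ} {s : St} {Q : St → Prop} {r : ℕ} {e : Expr} (hV : e.val s ≤ V)
    (h : Q (s.set r (e.val s))) : Tri V (.set r e) s Q := by
  intro hs c hc
  obtain ⟨c₁, e₁, p₁⟩ := e.exec hs 1 c hc
  have hres : c₁.reg 3 = e.val s := p₁.res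
  refine ⟨_, s.set r (e.val s), .seq e₁ (.instr _ _), ?_, hs.set hV, p₁.out, ?_, ?_, ?_, h⟩
  · have := p₁.rel.setReg_even r (e.val s) (Instr.cost c₁ (.copy (2 * r) 3))
    simpa only [Instr.effect, Config.tick, hres] using this
  · have := p₁.le_clock
    simp only [Instr.effect, Config.setReg, Config.tick]
    omega
  · have := p₁.clock_le
    have := size_le_self (e.val s)
    have := e.val_le_bound hs
    simp only [Instr.effect, Instr.cost, Config.setReg, Config.tick, hres, Stm.time]
    omega
  · intro q hq
    rw [St.set_reg, if_neg (by simpa using hq)]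

theorem Tri.store {V : ℕ} {s : St} {Q : St → Prop} {x y : Expr} (hV : y.val s ≤ V)
    (h : Q (s.put (x.val s) (y.val s))) : Tri V (.store x y) s Q := by
  intro hs c hc
  obtain ⟨c₁, e₁, p₁⟩ := x.exec hs 1 c hc
  obtain ⟨c₂, e₂, p₂⟩ := y.exec hs 2 c₁ p₁.rel
  have hx : c₂.reg 3 = x.val s := (p₂.scratch 1 (by omega)).trans p₁.res
  have hy : c₂.reg 5 = y.val s := p₂.res
  refine ⟨_, s.put (x.val s) (y.val s), .seq e₁ (.seq e₂ (.instr _ _)), ?_, hs.put hV,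
    p₂.out.trans p₁.out, ?_, ?_, fun _ _ => rfl, h⟩
  · refine ⟨p₂.rel.reg, ?_, p₂.rel.buf⟩
    simp [Instr.effect, Config.tick, hx, hy, St.put, p₂.rel.mem]
  · have := p₁.le_clock
    have := p₂.le_clock
    simp only [Instr.effect, Config.tick]
    omega
  · have := p₁.clock_le
    have := p₂.clock_le
    have := size_le_self (x.val s)
    have := x.val_le_bound hs
    have := size_le_self (y.val s)
    have := y.val_le_bound hs
    simp only [Instr.effect, Instr.cost, Config.tick, hx, hy, Stm.time]
    omega

theorem Tri.write {V : ℕ} {s : St} {Q : St → Prop} {e : Expr}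
    (h : Q { s with buf := s.buf ++ [e.val s] }) : Tri V (.write e) s Q := by
  intro hs c hc
  obtain ⟨c₁, e₁, p₁⟩ := e.exec hs 1 c hc
  have hres : c₁.reg 3 = e.val s := p₁.res
  refine ⟨_, { s with buf := s.buf ++ [e.val s] }, .seq e₁ (.instr _ _), ?_, ⟨hs.reg, hs.mem⟩,
    p₁.out, ?_, ?_, fun _ _ => rfl, h⟩
  · refine ⟨p₁.rel.reg, p₁.rel.mem, ?_⟩
    simp [Instr.effect, Config.tick, hres, p₁.rel.buf]
  · have := p₁.le_clock
    simp only [Instr.effect, Config.tick]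
    omega
  · have := p₁.clock_le
    have := size_le_self (e.val s)
    have := e.val_le_bound hs
    simp only [Instr.effect, Instr.cost, Config.tick, hres, Stm.time]
    omega

theorem Tri.seq {V : ℕ} {s : St} {Q : St → Prop} {p q : Stm}
    (h : Tri V p s (fun s' => Tri V q s' Q)) : Tri V (.seq p q) s Q := by
  intro hs c hc
  obtain ⟨c₁, s₁, e₁, r₁, b₁, o₁, l₁, t₁, f₁, h₁⟩ := h hs c hc
  obtain ⟨c₂, s₂, e₂, r₂, b₂, o₂, l₂, t₂, f₂, h₂⟩ := h₁ b₁ c₁ r₁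
  refine ⟨c₂, s₂, .seq e₁ e₂, r₂, b₂, o₂.trans o₁, l₁.trans l₂, ?_, ?_, h₂⟩
  · simp only [Stm.time]
    omega
  · intro r hr
    simp only [Stm.writes, List.mem_append, not_or] at hr
    rw [f₂ r hr.2, f₁ r hr.1]

theorem Tri.ite {V : ℕ} {s : St} {Q : St → Prop} {e : Expr} {p q : Stm}
    (hp : e.val s ≠ 0 → Tri V p s Q) (hq : e.val s = 0 → Tri V q s Q) :
    Tri V (.ite e p q) s Q := by
  intro hs c hc
  obtain ⟨c₁, e₁, p₁⟩ := e.exec hs 1 c hc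
  have hres : c₁.reg 3 = e.val s := p₁.res
  have h1 := p₁.le_clock
  have h2 := p₁.clock_le
  have h3 := size_le_self (e.val s)
  have h4 := e.val_le_bound hs
  by_cases h0 : e.val s = 0
  · obtain ⟨c₂, s₂, e₂, r₂, b₂, o₂, l₂, t₂, f₂, h₂⟩ := hq h0 hs _ (p₁.rel.tick 1)
    refine ⟨c₂, s₂, .seq e₁ (.branch_false (hres.trans h0) e₂), r₂, b₂, o₂.trans p₁.out, ?_, ?_,
      fun r hr => f₂ r fun h => hr (List.mem_append_right _ h), h₂⟩ <;>
    simp only [Config.tick, Stm.time] at * <;> omega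
  · obtain ⟨c₂, s₂, e₂, r₂, b₂, o₂, l₂, t₂, f₂, h₂⟩ :=
      hp h0 hs _ (p₁.rel.tick (1 + (c₁.reg 3).size))
    refine ⟨c₂, s₂, .seq e₁ (.branch_true (by rwa [hres]) e₂), r₂, b₂, o₂.trans p₁.out, ?_, ?_,
      fun r hr => f₂ r fun h => hr (List.mem_append_left _ h), h₂⟩ <;>
    simp only [Config.tick, Stm.time, hres] at * <;> omega

/-- The loop of a `loop` statement, started with `k` rounds left. -/
theorem Tri.loop_aux {V : ℕ} {i n : ℕ} {p : Stm} {N : ℕ} {s : St} (I : ℕ → St → Prop)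
    (hi : i ∉ p.writes) (hn : n ∉ p.writes) (hin : n ≠ i) (hN : N ≤ V) (hsN : s.reg n = N)
    (hstep : ∀ j < N, ∀ s', s'.Bdd V → (∀ r, r ≠ i → r ∉ p.writes → s'.reg r = s.reg r) →
      s'.reg i = j → I j s' → Tri V p s' (fun s'' => I (j + 1) (s''.set i (j + 1)))) :
    ∀ k j, j + k = N → ∀ s', s'.Bdd V → (∀ r, r ≠ i → r ∉ p.writes → s'.reg r = s.reg r) →
      s'.reg i = j → I j s' → ∀ c, Rel c s' → c.reg 1 = k →
      ∃ c' s'', Exec (.loop 1 (.seq p.code (.seq (.instr (.const 3 1))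
        (.seq (.instr (.add (2 * i) (2 * i) 3)) (.instr (.sub 1 (2 * n) (2 * i))))))) c c' ∧
        Rel c' s'' ∧ s''.Bdd V ∧ c'.out = c.out ∧
        c.clock ≤ c'.clock ∧ c'.clock ≤ c.clock + (k * (p.time V + (4 * V + 10)) + 1) ∧
        (∀ r, r ≠ i → r ∉ p.writes → s''.reg r = s.reg r) ∧ I N s'' := by
  intro k
  induction k with
  | zero =>
    intro j hj s' hb hf hij hI c hc h1
    refine ⟨_, s', .loop_done h1, hc.tick 1, hb, rfl, ?_, ?_, hf, ?_⟩
    · simp [Config.tick]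
    · simp [Config.tick]
    · obtain rfl : j = N := by omega
      exact hI
  | succ k ih =>
    intro j hj s' hb hf hij hI c hc h1
    obtain ⟨c₁, s₁, e₁, r₁, b₁, o₁, l₁, t₁, f₁, q₁⟩ :=
      hstep j (by omega) s' hb hf hij hI hb _ (hc.tick (1 + (c.reg 1).size))
    set c₂ := (c₁.tick (Instr.cost c₁ (.const 3 1))).setReg (2 * 1 + 1) 1 with hc₂
    have r₂ : Rel c₂ s₁ := r₁.setReg_odd 1 1 _
    have hsi : s₁.reg i = j := (f₁ i hi).trans hij
    have hsn : s₁.reg n = N := (f₁ n hn).trans ((hf n hin hn).trans hsN)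
    have h3 : c₂.reg 3 = 1 := by simp [hc₂, Config.setReg]
    have hci : c₂.reg (2 * i) = j := (r₂.reg i).trans hsi
    set c₃ := (c₂.tick (Instr.cost c₂ (.add (2 * i) (2 * i) 3))).setReg (2 * i) (j + 1) with hc₃
    have r₃ : Rel c₃ (s₁.set i (j + 1)) := r₂.setReg_even i (j + 1) _
    set c₄ := (c₃.tick (Instr.cost c₃ (.sub 1 (2 * n) (2 * i)))).setReg (2 * 0 + 1) k with hc₄
    have r₄ : Rel c₄ (s₁.set i (j + 1)) := r₃.setReg_odd 0 k _
    have e₂ : Exec (.instr (.const 3 1)) c₁ c₂ := .instr _ _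
    have e₃ : Exec (.instr (.add (2 * i) (2 * i) 3)) c₂ c₃ := by
      have := Exec.instr (.add (2 * i) (2 * i) 3) c₂
      simp only [Instr.effect, Config.tick_reg, hci, h3] at this
      exact this
    have hci₃ : c₃.reg (2 * i) = j + 1 := by simpa using r₃.reg i
    have hcn₃ : c₃.reg (2 * n) = N := by simpa [hin, hsn] using r₃.reg n
    have e₄ : Exec (.instr (.sub 1 (2 * n) (2 * i))) c₃ c₄ := by
      have := Exec.instr (.sub 1 (2 * n) (2 * i)) c₃
      have hk : N - (j + 1) = k := by omega
      simp only [Instr.effect, Config.tick_reg, hci₃, hcn₃, hk] at this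
      exact this
    obtain ⟨c₅, s₅, e₅, r₅, b₅, o₅, l₅, t₅, f₅, q₅⟩ := ih (j + 1) (by omega) (s₁.set i (j + 1))
      (b₁.set (by omega)) (by
        intro r hr hr'
        rw [St.set_reg, if_neg hr, f₁ r hr', hf r hr hr'])
      (by simp) q₁ c₄ r₄ (by simp [hc₄, Config.setReg])
    refine ⟨c₅, s₅, .loop_again (by omega) (.seq e₁ (.seq e₂ (.seq e₃ e₄))) e₅, r₅, b₅,
      o₅.trans o₁, ?_, ?_, f₅, q₅⟩
    · simp only [hc₄, hc₃, hc₂, Config.setReg, Config.tick] at l₅ l₁ ⊢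
      omega
    -- Besides the body, a round pays for the loop test, the constant, the addition and the
    -- subtraction: four numbers up to `V` and a few units, within `4 * V + 10`.
    · have z1 : Nat.size 1 = 1 := by simp
      have z2 := size_le_self j
      have z3 := size_le_self (j + 1)
      have z4 := size_le_self N
      have z5 := size_le_self (k + 1)
      have y4 : c₄.clock = c₃.clock + (1 + N.size + (j + 1).size) := by
        rw [hc₄]
        simp only [Config.setReg, Config.tick, Instr.cost, hcn₃, hci₃]
      have y3 : c₃.clock = c₂.clock + (1 + j.size + Nat.size 1) := by
        rw [hc₃]
        simp only [Config.setReg, Config.tick, Instr.cost, hci, h3]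
      have y2 : c₂.clock = c₁.clock + (1 + Nat.size 1) := by
        rw [hc₂]
        simp only [Config.setReg, Config.tick, Instr.cost]
      simp only [Config.tick, h1] at t₁
      rw [Nat.succ_mul]
      omega

/-- The rule for `loop` statements: an invariant. -/
theorem Tri.loop {V : ℕ} {i n : ℕ} {p : Stm} {s : St} {Q : St → Prop} (I : ℕ → St → Prop)
    (hi : i ∉ p.writes) (hn : n ∉ p.writes) (hin : n ≠ i)
    (h0 : I 0 (s.set i 0))
    (hstep : ∀ j < s.reg n, ∀ s', s'.Bdd V →
      (∀ r, r ≠ i → r ∉ p.writes → s'.reg r = s.reg r) →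
      s'.reg i = j → I j s' → Tri V p s' (fun s'' => I (j + 1) (s''.set i (j + 1))))
    (hQ : ∀ s', I (s.reg n) s' → Q s') : Tri V (.loop i n p) s Q := by
  intro hs c hc
  set c₁ := (c.tick (Instr.cost c (.const (2 * i) 0))).setReg (2 * i) 0 with hc₁
  have r₁ : Rel c₁ (s.set i 0) := hc.setReg_even i 0 _
  set c₂ := (c₁.tick (Instr.cost c₁ (.sub 1 (2 * n) (2 * i)))).setReg (2 * 0 + 1) (s.reg n)
    with hc₂
  have r₂ : Rel c₂ (s.set i 0) := r₁.setReg_odd 0 _ _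
  have e₁ : Exec (.instr (.const (2 * i) 0)) c c₁ := .instr _ _
  have hci : c₁.reg (2 * i) = 0 := by simpa using r₁.reg i
  have hcn : c₁.reg (2 * n) = s.reg n := by simpa [hin] using r₁.reg n
  have e₂ : Exec (.instr (.sub 1 (2 * n) (2 * i))) c₁ c₂ := by
    have := Exec.instr (.sub 1 (2 * n) (2 * i)) c₁
    simp only [Instr.effect, Config.tick_reg, hci, hcn, Nat.sub_zero] at this
    exact this
  have y1 : c₁.clock = c.clock + (1 + Nat.size 0) := rfl
  have y2 : c₂.clock = c₁.clock + (1 + (s.reg n).size + Nat.size 0) := by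
    rw [hc₂]
    simp only [Config.setReg, Config.tick, Instr.cost, hcn, hci]
  have z0 : Nat.size 0 = 0 := by simp
  have z1 := size_le_self (s.reg n)
  have z2 := hs.reg n
  obtain ⟨c₅, s₅, e₅, r₅, b₅, o₅, l₅, t₅, f₅, q₅⟩ := Tri.loop_aux I hi hn hin z2 rfl hstep
    (s.reg n) 0 (by omega) (s.set i 0) (hs.set (by omega))
    (fun r hr _ => by rw [St.set_reg, if_neg hr]) (by simp) h0 c₂ r₂
    (by simp [hc₂, Config.setReg])
  refine ⟨c₅, s₅, .seq e₁ (.seq e₂ e₅), r₅, b₅, o₅, by omega, ?_, ?_, hQ _ q₅⟩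
  · have := Nat.mul_le_mul_right (p.time V + (4 * V + 10)) z2
    simp only [Stm.time]
    omega
  · intro r hr
    simp only [Stm.writes, List.mem_cons, not_or] at hr
    exact f₅ r hr.1 hr.2

/-- The rule for `loop` statements all of whose rounds increase the state in some preorder, and
round `j` of which establishes the persistent fact `P j`. -/
theorem Tri.loop_mono {V : ℕ} {i n : ℕ} {p : Stm} {s : St} (Le : St → St → Prop)
    (P : ℕ → St → Prop) {N : ℕ} (hN : s.reg n = N) (hi : i ∉ p.writes) (hn : n ∉ p.writes) (hin : n ≠ i)
    (hrefl : ∀ s j, Le s (s.set i j)) (htrans : ∀ s₁ s₂ s₃, Le s₁ s₂ → Le s₂ s₃ → Le s₁ s₃)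
    (hP : ∀ j s s', P j s → Le s s' → P j s')
    (hstep : ∀ j < N, ∀ s', (∀ r, r ≠ i → r ∉ p.writes → s'.reg r = s.reg r) →
      s'.reg i = j → Le s s' → Tri V p s' (fun s'' => Le s' s'' ∧ P j s'')) :
    Tri V (.loop i n p) s (fun s' => Le s s' ∧ ∀ j < N, P j s') := by
  subst hN
  refine Tri.loop (fun k s' => Le s s' ∧ ∀ j < k, P j s') hi hn hin ⟨hrefl s 0, by simp⟩ ?_
    (fun s' h => h)
  intro j hj s' _ hf hij ⟨hle, hall⟩
  refine (hstep j hj s' hf hij hle).imp fun s'' _ _ ⟨h1, h2⟩ => ?_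
  have h3 : Le s' (s''.set i (j + 1)) := htrans _ _ _ h1 (hrefl _ _)
  refine ⟨htrans _ _ _ hle h3, fun k hk => ?_⟩
  rcases Nat.lt_succ_iff_lt_or_eq.1 hk with h | rfl
  · exact hP k _ _ (hall k h) h3
  · exact hP k _ _ h2 (hrefl _ _)

/-! ### Polynomial bounds -/

/-- `f` is bounded by a polynomial. -/
def PolyBdd (f : ℕ → ℕ) : Prop := ∃ a d, ∀ N, 1 ≤ N → f N ≤ a * N ^ d

theorem PolyBdd.const (c : ℕ) : PolyBdd fun _ => c := ⟨c, 0, by simp⟩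

theorem PolyBdd.id : PolyBdd fun N => N := ⟨1, 1, by simp⟩

theorem PolyBdd.add {f g : ℕ → ℕ} (hf : PolyBdd f) (hg : PolyBdd g) :
    PolyBdd fun N => f N + g N := by
  obtain ⟨a, d, h⟩ := hf
  obtain ⟨b, e, k⟩ := hg
  refine ⟨a + b, d + e, fun N hN => ?_⟩
  have h1 : N ^ d ≤ N ^ (d + e) := Nat.pow_le_pow_right hN (by omega)
  have h2 : N ^ e ≤ N ^ (d + e) := Nat.pow_le_pow_right hN (by omega)
  rw [Nat.add_mul]
  exact Nat.add_le_add ((h N hN).trans (Nat.mul_le_mul_left _ h1))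
    ((k N hN).trans (Nat.mul_le_mul_left _ h2))

theorem PolyBdd.mul {f g : ℕ → ℕ} (hf : PolyBdd f) (hg : PolyBdd g) :
    PolyBdd fun N => f N * g N := by
  obtain ⟨a, d, h⟩ := hf
  obtain ⟨b, e, k⟩ := hg
  refine ⟨a * b, d + e, fun N hN => ?_⟩
  calc f N * g N ≤ (a * N ^ d) * (b * N ^ e) := Nat.mul_le_mul (h N hN) (k N hN)
    _ = a * b * N ^ (d + e) := by ring

theorem Expr.polyBdd_bound {V : ℕ → ℕ} (hV : PolyBdd V) (e : Expr) :
    PolyBdd fun N => e.bound (V N) := by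
  induction e with
  | reg r => exact hV
  | const c => exact .const c
  | add x y hx hy => exact hx.add hy
  | sub x y hx hy => exact hx
  | mul x y hx hy => exact hx.mul hy
  | load x hx => exact hV

theorem Expr.polyBdd_time {V : ℕ → ℕ} (hV : PolyBdd V) (e : Expr) :
    PolyBdd fun N => e.time (V N) := by
  have hb := fun e => Expr.polyBdd_bound hV e
  have h1 := PolyBdd.const 1
  induction e with
  | reg r => exact h1.add hV
  | const c => exact .const _
  | add x y hx hy => exact (hx.add hy).add ((h1.add (hb x)).add (hb y))
  | sub x y hx hy => exact (hx.add hy).add ((h1.add (hb x)).add (hb y))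
  | mul x y hx hy => exact (hx.add hy).add ((h1.add (hb x)).add (hb y))
  | load x hx => exact hx.add ((h1.add (hb x)).add hV)

/-- A loop multiplies the time by about `V`, and the nesting depth is fixed with the program, so
only boundedly many factors arise. -/
theorem Stm.polyBdd_time {V : ℕ → ℕ} (hV : PolyBdd V) (p : Stm) :
    PolyBdd fun N => p.time (V N) := by
  have hb := fun e => Expr.polyBdd_bound hV e
  have ht := fun e => Expr.polyBdd_time hV e
  have h1 := PolyBdd.const 1
  have h10 := PolyBdd.const 10
  induction p with
  | skip => exact .const 0
  | set r e => exact (ht e).add (h1.add (hb e))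
  | store x y => exact ((ht x).add (ht y)).add ((h1.add (hb x)).add (hb y))
  | write e => exact (ht e).add (h1.add (hb e))
  | seq p q hp hq => exact hp.add hq
  | ite e p q hp hq => exact ((ht e).add (h1.add (hb e))).add (hp.add hq)
  | loop i n p hp =>
    exact (hV.mul (hp.add (((PolyBdd.const 4).mul hV).add h10))).add
      (((PolyBdd.const 2).mul hV).add h10)

/-! ### Commuting permutations through prescribed pairs -/

section Extension

variable {α : Type*}

/-- `S` is closed under the diagonal action of the permutations in `gs`. -/
def ClosedUnder (gs : List (Perm α)) (S : Set (α × α)) : Prop :=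
  ∀ g ∈ gs, ∀ u v, (u, v) ∈ S → (g u, g v) ∈ S

/-- `S` is the graph of an injective partial function. -/
def PartialInj (S : Set (α × α)) : Prop :=
  ∀ u v w, ((u, v) ∈ S → (u, w) ∈ S → v = w) ∧ ((v, u) ∈ S → (w, u) ∈ S → v = w)

/-- The map `g × g` sends `S` injectively into itself, hence onto itself by finiteness. -/
theorem ClosedUnder.inv [Finite α] {gs : List (Perm α)} {S : Set (α × α)}
    (h : ClosedUnder gs S) {g : Perm α} (hg : g ∈ gs) {u v : α} (huv : (g u, g v) ∈ S) :
    (u, v) ∈ S := by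
  have hm : Set.MapsTo (Prod.map g g) S S := fun p hp => h g hg p.1 p.2 hp
  have hinj : Function.Injective (Prod.map g g) := g.injective.prodMap g.injective
  obtain ⟨⟨p, hp⟩, hpe⟩ :=
    Finite.surjective_of_injective (hm.restrict_inj.2 hinj.injOn) ⟨(g u, g v), huv⟩
  have : p = (u, v) := hinj (congrArg Subtype.val hpe)
  rwa [← this]

/-- Every point without successor is reached by a chain from a point without predecessor. -/
theorem exists_chain_start [Finite α] {S : Set (α × α)} (hS : PartialInj S) {u : α}
    (hu : ∀ v, (u, v) ∉ S) :
    ∃ v, (∀ w, (w, v) ∉ S) ∧ Relation.ReflTransGen (fun a b => (a, b) ∈ S) v u := by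
  -- Otherwise every point from which `u` can be reached has a predecessor of the same kind.
  -- Choosing predecessors is injective because `S` is functional, hence surjective, so `u` would be
  -- a predecessor of something.
  by_contra! hcon
  have hpred : ∀ x : {x // Relation.ReflTransGen (fun a b => (a, b) ∈ S) x u},
      ∃ y : {x // Relation.ReflTransGen (fun a b => (a, b) ∈ S) x u}, (y.1, x.1) ∈ S := by
    intro x
    by_contra! hx
    exact hcon x.1 (fun w hw => hx ⟨w, .head hw x.2⟩ hw) x.2
  choose f hf using hpred
  have hinj : Function.Injective f := fun x y hxy =>
    Subtype.ext ((hS (f x).1 _ _).1 (hf x) (by rw [hxy]; exact hf y))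
  obtain ⟨x, hx⟩ := Finite.surjective_of_injective hinj ⟨u, .refl⟩
  have := hf x
  rw [hx] at this
  exact hu _ this

/-- A closed injective partial function extends to a permutation that commutes with the given
permutations. -/
theorem exists_perm_of_partialInj [Finite α] {gs : List (Perm α)} {S : Set (α × α)}
    (hcl : ClosedUnder gs S) (hS : PartialInj S) :
    ∃ l : Perm α, (∀ g ∈ gs, Commute l g) ∧ ∀ u v, (u, v) ∈ S → l u = v := by
  set r : α → α → Prop := fun a b => (a, b) ∈ S with hr
  have hru : Relator.RightUnique r := fun a b c h1 h2 => (hS a b c).1 h1 h2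
  have hlu : Relator.RightUnique (Function.swap r) := fun a b c h1 h2 => (hS a b c).2 h1 h2
  -- `S` splits the points into cycles and chains. `T` closes each chain into a cycle by joining its
  -- end to its start; a point outside `S` is a chain of length zero and becomes fixed.
  set T : α → α → Prop := fun u v => (u, v) ∈ S ∨
    ((∀ w, (u, w) ∉ S) ∧ (∀ w, (w, v) ∉ S) ∧ Relation.ReflTransGen r v u) with hT
  have hend : ∀ u w, (∀ v, (u, v) ∉ S) → Relation.ReflTransGen r u w → u = w := by
    intro u w hu h
    rcases h.cases_head with h | ⟨c, hc, _⟩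
    exacts [h, (hu c hc).elim]
  have hstart : ∀ w v, (∀ u, (u, v) ∉ S) → Relation.ReflTransGen r w v → w = v := by
    intro w v hv h
    rcases h.cases_tail with h | ⟨c, _, hc⟩
    exacts [h.symm, (hv c hc).elim]
  have hfun : ∀ u v v', T u v → T u v' → v = v' := by
    rintro u v v' (h | ⟨h1, h2, h3⟩) (h' | ⟨h1', h2', h3'⟩)
    · exact (hS _ _ _).1 h h'
    · exact (h1' _ h).elim
    · exact (h1 _ h').elim
    · have h4 := Relation.reflTransGen_swap.2 h3
      have h5 := Relation.reflTransGen_swap.2 h3'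
      rcases Relation.ReflTransGen.total_of_right_unique hlu h4 h5 with h | h
      · exact (hstart _ _ h2 (Relation.reflTransGen_swap.1 h)).symm
      · exact hstart _ _ h2' (Relation.reflTransGen_swap.1 h)
  have hinj : ∀ u u' v, T u v → T u' v → u = u' := by
    rintro u u' v (h | ⟨h1, h2, h3⟩) (h' | ⟨h1', h2', h3'⟩)
    · exact (hS _ _ _).2 h h'
    · exact (h2' _ h).elim
    · exact (h2 _ h').elim
    · rcases Relation.ReflTransGen.total_of_right_unique hru h3 h3' with h | h
      · exact hend _ _ h1 h
      · exact (hend _ _ h1' h).symm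
  have htot : ∀ u, ∃ v, T u v := by
    intro u
    by_cases hu : ∃ v, (u, v) ∈ S
    · exact hu.imp fun v hv => Or.inl hv
    · push Not at hu
      obtain ⟨v, h1, h2⟩ := exists_chain_start hS hu
      exact ⟨v, Or.inr ⟨hu, h1, h2⟩⟩
  -- Having no successor or no predecessor passes from a point to its image because `S` is also
  -- closed under `g⁻¹`.
  have hequiv : ∀ g ∈ gs, ∀ u v, T u v → T (g u) (g v) := by
    rintro g hg u v (h | ⟨h1, h2, h3⟩)
    · exact Or.inl (hcl g hg u v h)
    · refine Or.inr ⟨fun w hw => h1 (g⁻¹ w) (hcl.inv hg ?_), fun w hw => h2 (g⁻¹ w) (hcl.inv hg ?_),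
        h3.lift g fun a b hab => hcl g hg a b hab⟩
      · simpa using hw
      · simpa using hw
  choose f hf using htot
  have hf' : Function.Injective f := fun a b hab => hinj a b (f a) (hf a) (hab ▸ hf b)
  refine ⟨Equiv.ofBijective f (Finite.injective_iff_bijective.1 hf'), fun g hg => ?_, ?_⟩
  · ext u
    exact hfun _ _ _ (hf (g u)) (hequiv g hg _ _ (hf u))
  · exact fun u v huv => hfun u _ _ (hf u) (Or.inl huv)

theorem graph_closedUnder {gs : List (Perm α)} {l : Perm α} (hl : ∀ g ∈ gs, Commute l g) :
    ClosedUnder gs {p | l p.1 = p.2} := by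
  intro g hg u v huv
  have := congrArg (· u) (hl g hg).eq
  simp only [Perm.mul_apply] at this
  simp only [Set.mem_ofPred_eq] at huv ⊢
  rw [this, huv]

/-- The least closed relation above `S` is an injective partial function iff `S` lies in the graph
of a commuting permutation. -/
theorem partialInj_closure_iff [Finite α] {gs : List (Perm α)} {S C : Set (α × α)}
    (hcl : ClosedUnder gs C) (hSC : S ⊆ C) (hmin : ∀ D, ClosedUnder gs D → S ⊆ D → C ⊆ D) :
    PartialInj C ↔ ∃ l : Perm α, (∀ g ∈ gs, Commute l g) ∧ ∀ u v, (u, v) ∈ S → l u = v := by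
  constructor
  · intro h
    obtain ⟨l, h1, h2⟩ := exists_perm_of_partialInj hcl h
    exact ⟨l, h1, fun u v huv => h2 u v (hSC huv)⟩
  -- The graph of a commuting permutation is itself closed, so by minimality it contains `C`.
  · rintro ⟨l, h1, h2⟩ u v w
    have hC := hmin _ (graph_closedUnder h1) fun p hp => h2 p.1 p.2 hp
    refine ⟨fun hv hw => ?_, fun hv hw => ?_⟩
    · have := hC hv
      have := hC hw
      simp_all
    · have h3 := hC hv
      have h4 := hC hw
      simp only [Set.mem_ofPred_eq] at h3 h4
      exact l.injective (h3.trans h4.symm)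

end Extension

/-! ### Canonical representatives of cosets -/

/-- `l` is lexicographically minimal among its left translates by `C`. -/
def Canon {m : ℕ} (C : Subgroup (Perm (Fin m))) (l : Perm (Fin m)) : Prop :=
  ∀ k, ∀ c ∈ C, (∀ j < k, c (l j) = l j) → l k ≤ c (l k)

/-- Take the translate with the lexicographically least sequence of values: a violation at position
`k` would produce a smaller one. -/
theorem exists_canon {m : ℕ} (C : Subgroup (Perm (Fin m))) (l : Perm (Fin m)) :
    ∃ c ∈ C, Canon C (c * l) := by
  obtain ⟨c, hc, hmin⟩ := Set.exists_min_image (C : Set (Perm (Fin m)))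
    (fun c => toLex fun i => (c * l) i) (Set.toFinite _) ⟨1, C.one_mem⟩
  refine ⟨c, hc, fun k d hd hfix => ?_⟩
  by_contra! hlt
  refine (hmin (d * c) (C.mul_mem hd hc)).not_gt ?_
  exact ⟨k, fun j hj => by simpa using hfix j hj, by simpa using hlt⟩

/-- Passing to the least translate does not disturb a prefix that is already least. By induction on
the position, the hypothesis gives one inequality, and canonicity of `c * l` tested against `c⁻¹`
gives the other. -/
theorem exists_canon_agree {m : ℕ} {C : Subgroup (Perm (Fin m))} {l : Perm (Fin m)} (k : ℕ)
    (hl : ∀ i : Fin m, i.val < k → ∀ c ∈ C, (∀ j < i, c (l j) = l j) → l i ≤ c (l i)) :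
    ∃ c ∈ C, Canon C (c * l) ∧ ∀ i : Fin m, i.val < k → c (l i) = l i := by
  obtain ⟨c, hc, hcan⟩ := exists_canon C l
  refine ⟨c, hc, hcan, fun i => ?_⟩
  induction i using WellFoundedLT.induction with
  | _ i ih =>
    intro hi
    have hfix : ∀ j < i, c (l j) = l j := fun j hj => ih j hj (lt_trans hj hi)
    refine le_antisymm ?_ (hl i hi c hc hfix)
    have := hcan i c⁻¹ (C.inv_mem hc) fun j hj => by simp [Equiv.symm_apply_eq, hfix j hj]
    simpa using this

/-- Testing each of the two against the other shows position by position that they agree, so a coset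
has only one canonical element. -/
theorem Canon.eq {m : ℕ} {C : Subgroup (Perm (Fin m))} {l c : Perm (Fin m)} (hl : Canon C l)
    (hc : c ∈ C) (hcl : Canon C (c * l)) : c * l = l := by
  have h : ∀ i, c (l i) = l i := by
    intro i
    induction i using WellFoundedLT.induction with
    | _ i ih =>
      refine le_antisymm ?_ (hl i c hc ih)
      have := hcl i c⁻¹ (C.inv_mem hc) fun j hj => by simp [Equiv.symm_apply_eq, ih j hj]
      simpa using this
  ext i
  simp [h i]

/-- The step of the search: given that the values `F i` for `i < k` are those of a canonical
element, the value `y` at `k` is possible iff it is compatible with `D` and no smaller value is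
equivalent to it under the stabilizer of the previous values in `C`. -/
theorem canon_step {m : ℕ} {C D : Subgroup (Perm (Fin m))} (hCD : C ≤ D) {F : Fin m → Fin m}
    {k : Fin m} (h : ∃ l ∈ D, Canon C l ∧ ∀ i < k, l i = F i) (y : Fin m) :
    (∃ l ∈ D, Canon C l ∧ (∀ i < k, l i = F i) ∧ l k = y) ↔
      (∃ l ∈ D, (∀ i < k, l i = F i) ∧ l k = y) ∧
        ∀ z < y, ¬ ∃ c ∈ C, (∀ i < k, c (F i) = F i) ∧ c z = y := by
  constructor
  · rintro ⟨l, hl, hcan, hF, rfl⟩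
    refine ⟨⟨l, hl, hF, rfl⟩, ?_⟩
    rintro z hz ⟨c, hc, hfix, hcz⟩
    have := hcan k c⁻¹ (C.inv_mem hc) fun j hj => by
      rw [hF j hj, Perm.inv_eq_iff_eq, hfix j hj]
    rw [← hcz] at this hz
    exact absurd hz (by simpa using this)
  · rintro ⟨⟨l, hl, hF, rfl⟩, hmin⟩
    obtain ⟨l₀, -, hcan₀, hF₀⟩ := h
    -- `l` need not be canonical, but its least translate keeps the values up to and including `k`:
    -- below `k` they are those of the canonical `l₀`, and at `k` the value is least in its orbit by
    -- assumption.
    obtain ⟨c, hc, hcan, hagree⟩ := exists_canon_agree (C := C) (l := l) (k + 1) (by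
      intro i hi c hc hfix
      rcases lt_or_eq_of_le (Fin.le_def.2 (Nat.lt_succ_iff.1 hi)) with hik | rfl
      · rw [hF i hik, ← hF₀ i hik]
        refine hcan₀ i c hc fun j hj => ?_
        rw [hF₀ j (hj.trans hik), ← hF j (hj.trans hik)]
        exact hfix j hj
      · by_contra! hlt
        refine hmin _ hlt ⟨c⁻¹, C.inv_mem hc, fun j hj => ?_, by simp⟩
        rw [Perm.inv_eq_iff_eq, ← hF j hj, hfix j hj])
    refine ⟨c * l, D.mul_mem (hCD hc) hl, hcan, fun i hi => ?_, ?_⟩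
    · rw [← hF i hi]
      exact hagree i (Nat.lt_succ_of_lt hi)
    · exact hagree k (Nat.lt_succ_self _)

/-! ### Extensions and centralizers -/

section Classes

variable {n m : ℕ} {M G : Subgroup (Perm (Fin n))}

theorem mem_centralizer_range_iff {H : Type*} [Group H] (f : H →* Perm (Fin m))
    (c : Perm (Fin m)) :
    c ∈ Subgroup.centralizer (f.range : Set (Perm (Fin m))) ↔ ∀ x, Commute c (f x) := by
  rw [Subgroup.mem_centralizer_iff]
  constructor
  · exact fun h x => (h (f x) ⟨x, rfl⟩).symm
  · rintro h _ ⟨x, rfl⟩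
    exact (h x).eq.symm

/-- Commuting with `c` passes to products and inverses. This lets the program work with the tables
of values on generators alone. -/
theorem mem_centralizer_iff_gens {H : Type*} [Group H] (f : H →* Perm (Fin m)) {B : List H}
    (hB : Subgroup.closure {x : H | x ∈ B} = ⊤) (c : Perm (Fin m)) :
    c ∈ Subgroup.centralizer (f.range : Set (Perm (Fin m))) ↔ ∀ g ∈ B.map f, Commute c g := by
  rw [mem_centralizer_range_iff]
  constructor
  · intro h g hg
    obtain ⟨x, -, rfl⟩ := List.mem_map.1 hg
    exact h x
  · intro h x
    have hx : x ∈ Subgroup.closure {x : H | x ∈ B} := hB ▸ Subgroup.mem_top x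
    induction hx using Subgroup.closure_induction with
    | mem x hx => exact h _ (List.mem_map_of_mem hx)
    | one => simp
    | mul x y _ _ hx hy => rw [map_mul]; exact hx.mul_right hy
    | inv x _ hx => rw [map_inv]; exact hx.inv_right

/-- The conjugates of φ are thus parametrized by right cosets of the centralizer of its image. -/
theorem conjAction_eq_iff (φ : G →* Perm (Fin m)) (a b : Perm (Fin m)) :
    conjAction φ a = conjAction φ b ↔
      a * b⁻¹ ∈ Subgroup.centralizer (φ.range : Set (Perm (Fin m))) := by
  rw [mem_centralizer_range_iff, MonoidHom.ext_iff]
  refine forall_congr' fun x => ?_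
  rw [commute_iff_eq]
  change a⁻¹ * φ x * a = b⁻¹ * φ x * b ↔ _
  constructor
  · intro h
    calc a * b⁻¹ * φ x = a * (b⁻¹ * φ x * b) * b⁻¹ := by group
      _ = a * (a⁻¹ * φ x * a) * b⁻¹ := by rw [h]
      _ = φ x * (a * b⁻¹) := by group
  · intro h
    calc a⁻¹ * φ x * a = a⁻¹ * (φ x * (a * b⁻¹)) * b := by group
      _ = a⁻¹ * (a * b⁻¹ * φ x) * b := by rw [h]
      _ = b⁻¹ * φ x * b := by group

theorem extends_conjAction_iff {h : M ≤ G} {ψ : M →* Perm (Fin m)} {φ : G →* Perm (Fin m)}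
    (hφ : Extends h ψ φ) (c : Perm (Fin m)) :
    Extends h ψ (conjAction φ c) ↔ c ∈ Subgroup.centralizer (ψ.range : Set (Perm (Fin m))) := by
  rw [mem_centralizer_range_iff]
  refine forall_congr' fun x => ?_
  change c⁻¹ * φ _ * c = ψ x ↔ _
  rw [hφ x, commute_iff_eq]
  constructor
  · intro h
    calc c * ψ x = c * (c⁻¹ * ψ x * c) := by rw [h]
      _ = ψ x * c := by group
  · intro h
    rw [mul_assoc, ← h]
    group

theorem equivalentExtensions_iff {h : M ≤ G} {ψ : M →* Perm (Fin m)} {φ : G →* Perm (Fin m)}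
    (hφ : Extends h ψ φ) (χ : G →* Perm (Fin m)) :
    EquivalentExtensions h ψ χ φ ↔
      ∃ c ∈ Subgroup.centralizer (ψ.range : Set (Perm (Fin m))), χ = conjAction φ c := by
  constructor
  · rintro ⟨h1, -, c, rfl⟩
    exact ⟨c, (extends_conjAction_iff hφ c).1 h1, rfl⟩
  · rintro ⟨c, hc, rfl⟩
    exact ⟨(extends_conjAction_iff hφ c).2 hc, hφ, c, rfl⟩

theorem centralizer_le {h : M ≤ G} {ψ : M →* Perm (Fin m)} {φ : G →* Perm (Fin m)}
    (hφ : Extends h ψ φ) :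
    Subgroup.centralizer (φ.range : Set (Perm (Fin m))) ≤
      Subgroup.centralizer (ψ.range : Set (Perm (Fin m))) := by
  intro c hc
  rw [mem_centralizer_range_iff] at hc ⊢
  intro x
  rw [← hφ x]
  exact hc _

/-- The index counts left cosets while equal conjugates form right cosets; sending `a` to the
conjugate by `a⁻¹` reconciles the two. -/
theorem card_equivalentExtensions {h : M ≤ G} {ψ : M →* Perm (Fin m)} {φ : G →* Perm (Fin m)}
    (hφ : Extends h ψ φ) :
    Nat.card {χ : G →* Perm (Fin m) // EquivalentExtensions h ψ χ φ} =
      (Subgroup.centralizer (φ.range : Set (Perm (Fin m)))).relIndex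
        (Subgroup.centralizer (ψ.range : Set (Perm (Fin m)))) := by
  set K := Subgroup.centralizer (ψ.range : Set (Perm (Fin m)))
  set C := Subgroup.centralizer (φ.range : Set (Perm (Fin m)))
  have hiff : ∀ a b : K, (QuotientGroup.leftRel (C.subgroupOf K)) a b ↔
      conjAction φ (a : Perm (Fin m))⁻¹ = conjAction φ (b : Perm (Fin m))⁻¹ := by
    intro a b
    rw [QuotientGroup.leftRel_apply, conjAction_eq_iff, Subgroup.mem_subgroupOf]
    simp [C]
  symm
  refine Nat.card_congr (Equiv.ofBijective (Quotient.lift (fun a : K =>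
    (⟨conjAction φ (a : Perm (Fin m))⁻¹, (equivalentExtensions_iff hφ _).2
      ⟨_, K.inv_mem a.2, rfl⟩⟩ : {χ : G →* Perm (Fin m) // EquivalentExtensions h ψ χ φ}))
    fun a b hab => Subtype.ext ((hiff a b).1 hab)) ⟨?_, ?_⟩)
  · rintro ⟨a⟩ ⟨b⟩ hab
    exact Quotient.sound ((hiff a b).2 (congrArg Subtype.val hab))
  · rintro ⟨χ, hχ⟩
    obtain ⟨c, hc, rfl⟩ := (equivalentExtensions_iff hφ _).1 hχ
    exact ⟨Quotient.mk _ ⟨c⁻¹, K.inv_mem hc⟩, Subtype.ext (by simp)⟩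

/-- The equivalent extensions are listed by the canonical elements of the centralizer. -/
theorem nodup_and_mem_of_canon {h : M ≤ G} {ψ : M →* Perm (Fin m)} {φ : G →* Perm (Fin m)}
    (hφ : Extends h ψ φ) {L : List (Perm (Fin m))} (hL : L.Nodup)
    (hmem : ∀ l, l ∈ L ↔ l ∈ Subgroup.centralizer (ψ.range : Set (Perm (Fin m))) ∧
      Canon (Subgroup.centralizer (φ.range : Set (Perm (Fin m)))) l) :
    (L.map (conjAction φ)).Nodup ∧
      ∀ χ, χ ∈ L.map (conjAction φ) ↔ EquivalentExtensions h ψ χ φ := by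
  constructor
  · refine List.Nodup.map_on ?_ hL
    intro a ha b hb hab
    have := ((hmem b).1 hb).2.eq ((conjAction_eq_iff φ a b).1 hab)
      (by simpa using ((hmem a).1 ha).2)
    simpa using this
  · intro χ
    rw [List.mem_map, equivalentExtensions_iff hφ]
    constructor
    · rintro ⟨l, hl, rfl⟩
      exact ⟨l, ((hmem l).1 hl).1, rfl⟩
    · rintro ⟨l, hl, rfl⟩
      obtain ⟨c, hc, hcan⟩ := exists_canon (Subgroup.centralizer (φ.range : Set _)) l
      refine ⟨c * l, (hmem _).2 ⟨Subgroup.mul_mem _ (centralizer_le hφ hc) hl, hcan⟩, ?_⟩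
      rw [conjAction_eq_iff]
      simpa using hc

end Classes

/-! ### Relations in memory -/

theorem mul_add_lt {a A u m : ℕ} (ha : a < A) (hu : u < m) : a * m + u < A * m :=
  calc a * m + u < a * m + m := by omega
    _ = (a + 1) * m := by ring
    _ ≤ A * m := Nat.mul_le_mul_right _ ha

/-- Row-major addressing is injective, so storing one matrix entry affects one pair of the relation
only. -/
theorem mul_add_inj {m u u' v v' : ℕ} (hv : v < m) (hv' : v' < m) :
    u * m + v = u' * m + v' ↔ u = u' ∧ v = v' := by
  constructor
  · intro h
    have h1 : u = u' := by
      have := congrArg (· / m) h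
      have hm : 0 < m := by omega
      simpa [Nat.mul_comm _ m, Nat.mul_add_div hm, Nat.div_eq_of_lt hv, Nat.div_eq_of_lt hv']
        using this
    subst h1
    exact ⟨rfl, by omega⟩
  · rintro ⟨rfl, rfl⟩
    rfl

/-- The relation on `Fin m` that is stored as a matrix at the address `b`. -/
def relSet (m b : ℕ) (s : St) : Set (Fin m × Fin m) :=
  {p | s.mem (b + (p.1 * m + p.2)) ≠ 0}

theorem mem_relSet {m b : ℕ} {s : St} {u v : Fin m} :
    (u, v) ∈ relSet m b s ↔ s.mem (b + (u * m + v)) ≠ 0 := Iff.rfl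

theorem relSet_put {m b : ℕ} (s : St) (u v : Fin m) :
    relSet m b (s.put (b + (u * m + v)) 1) = insert (u, v) (relSet m b s) := by
  ext ⟨u', v'⟩
  have key : b + ((u' : ℕ) * m + v') = b + (u * m + v) ↔ u' = u ∧ v' = v := by
    rw [Nat.add_left_cancel_iff, mul_add_inj v'.2 v.2, Fin.ext_iff, Fin.ext_iff]
  rw [Set.mem_insert_iff, mem_relSet, mem_relSet, St.put_mem, Prod.mk.injEq, ← key]
  split_ifs with h
  · simp [h]
  · exact (or_iff_right h).symm

theorem relSet_congr {m b : ℕ} {s s' : St} (h : s'.mem = s.mem) :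
    relSet m b s' = relSet m b s := by
  simp [relSet, h]

/-- The table of the permutations `gs` stands in memory at the address `bg`. -/
def Table {m : ℕ} (gs : List (Perm (Fin m))) (bg : ℕ) (mem : ℕ → ℕ) : Prop :=
  ∀ a (h : a < gs.length) (u : Fin m), mem (bg + (a * m + u)) = (gs[a] u : Fin m)

/-- The working storage lies behind the tables, so they survive every write of the search. -/
theorem Table.congr {m : ℕ} {gs : List (Perm (Fin m))} {bg b : ℕ} {mem mem' : ℕ → ℕ}
    (h : Table gs bg mem) (hb : bg + gs.length * m ≤ b) (hmem : ∀ a < b, mem' a = mem a) :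
    Table gs bg mem' := by
  intro a ha u
  have := mul_add_lt ha u.2
  rw [hmem _ (by omega), h a ha u]

/-- The address of the matrix entry with the given indices. Register `0` holds the degree, and
register `6` the address of the matrix. -/
@[simp] def cell (x y : Expr) : Expr := .add (.reg 6) (.add (.mul x (.reg 0)) y)

/-- The value at a point of the generator with the number in register `16`, in the table whose
address stands in register `13`. -/
@[simp] def genVal (x : Expr) : Expr := .load (.add (.reg 13) (.add (.mul (.reg 16) (.reg 0)) x))

/-- The value at a point of the partial map stored behind the address in register `5`. -/
@[simp] def mapVal (x : Expr) : Expr := .load (.add (.add (.reg 5) (.const 1)) x)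

/-- Zero iff the two values are equal. -/
@[simp] def dist (x y : Expr) : Expr := .add (.sub x y) (.sub y x)

/-! ### Closure of a relation under permutations -/

/-- Add the image of one pair under one generator. -/
def closeStep : Stm :=
  .ite (.load (cell (.reg 17) (.reg 18)))
    (.store (cell (genVal (.reg 17)) (genVal (.reg 18))) (.const 1)) .skip

/-- Add the images of all pairs under all generators. -/
def closeRound : Stm := .loop 16 12 (.loop 17 0 (.loop 18 0 closeStep))

/-- Close the relation under the generators. -/
def closeStm : Stm := .loop 15 14 closeRound

/-- The transitions that occur during the closure. -/
def CloseLe {m : ℕ} (gs : List (Perm (Fin m))) (b : ℕ) (s s' : St) : Prop :=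
  (∀ a < b, s'.mem a = s.mem a) ∧ s'.buf = s.buf ∧ relSet m b s ⊆ relSet m b s' ∧
    ∀ C, ClosedUnder gs C → relSet m b s ⊆ C → relSet m b s' ⊆ C

theorem CloseLe.trans {m : ℕ} {gs : List (Perm (Fin m))} {b : ℕ} (s₁ s₂ s₃ : St)
    (h : CloseLe gs b s₁ s₂) (h' : CloseLe gs b s₂ s₃) : CloseLe gs b s₁ s₃ :=
  ⟨fun a ha => (h'.1 a ha).trans (h.1 a ha), h'.2.1.trans h.2.1, h.2.2.1.trans h'.2.2.1,
    fun C hC hs => h'.2.2.2 C hC (h.2.2.2 C hC hs)⟩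

theorem CloseLe.set {m : ℕ} {gs : List (Perm (Fin m))} {b i : ℕ} (s : St) (j : ℕ) :
    CloseLe gs b s (s.set i j) :=
  ⟨fun _ _ => rfl, rfl, subset_rfl, fun _ _ h => h⟩

section Closure

variable {V m b bg : ℕ} {gs : List (Perm (Fin m))} {s : St}

theorem tri_closeStep (hV : 1 ≤ V) (h0 : s.reg 0 = m) (h6 : s.reg 6 = b) (h13 : s.reg 13 = bg)
    (hT : Table gs bg s.mem) {a : ℕ} (ha : a < gs.length) (h16 : s.reg 16 = a) {u v : Fin m}
    (h17 : s.reg 17 = u) (h18 : s.reg 18 = v) :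
    Tri V closeStep s (fun s' => CloseLe gs b s s' ∧
      ((u, v) ∈ relSet m b s → (gs[a] u, gs[a] v) ∈ relSet m b s')) := by
  refine Tri.ite (fun h => Tri.store hV ?_) (fun h => Tri.skip ?_)
  · have huv : (u, v) ∈ relSet m b s := by simpa [mem_relSet, h0, h6, h17, h18] using h
    have hx : (cell (genVal (.reg 17)) (genVal (.reg 18))).val s =
        b + ((gs[a] u : Fin m) * m + (gs[a] v : Fin m)) := by
      simp [h0, h6, h13, h16, h17, h18, hT a ha u, hT a ha v]
    rw [hx]
    change CloseLe gs b s (s.put _ 1) ∧ (_ → _ ∈ relSet m b (s.put _ 1))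
    refine ⟨⟨fun q hq => ?_, rfl, ?_, fun C hC hs => ?_⟩, fun _ => ?_⟩
    · rw [St.put_mem, if_neg (by omega)]
    · rw [relSet_put]
      exact Set.subset_insert _ _
    · rw [relSet_put]
      exact Set.insert_subset (hC _ (List.getElem_mem ha) u v (hs huv)) hs
    · rw [relSet_put]
      exact Set.mem_insert _ _
  · refine ⟨⟨fun _ _ => rfl, rfl, subset_rfl, fun _ _ h => h⟩, fun huv => ?_⟩
    rw [mem_relSet] at huv
    simp [h0, h6, h17, h18] at h
    exact (huv h).elim

/-- Pairs added during the round may be used in it as well. Only the images of the pairs present at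
its start are claimed; this already forces growth unless the relation is closed. -/
theorem tri_closeRound (hV : 1 ≤ V) (h0 : s.reg 0 = m) (h6 : s.reg 6 = b) (h13 : s.reg 13 = bg)
    (h12 : s.reg 12 = gs.length) (hT : Table gs bg s.mem) (hb : bg + gs.length * m ≤ b) :
    Tri V closeRound s (fun s' => CloseLe gs b s s' ∧ ∀ g ∈ gs, ∀ u v,
      (u, v) ∈ relSet m b s → (g u, g v) ∈ relSet m b s') := by
  -- The bounds on `u` and `v` occur twice: first in the shape in which the inner loops deliver
  -- them, then as the proofs needed to form elements of `Fin m`.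
  refine (Tri.loop_mono (CloseLe gs b) (fun a s' => ∀ u < m, ∀ v < m,
    ∀ (ha : a < gs.length) (hu : u < m) (hv : v < m),
      ((⟨u, hu⟩, ⟨v, hv⟩) : Fin m × Fin m) ∈ relSet m b s →
      (gs[a] ⟨u, hu⟩, gs[a] ⟨v, hv⟩) ∈ relSet m b s') h12 (by decide) (by decide)
    (by decide) CloseLe.set CloseLe.trans ?_ ?_).imp ?_
  · exact fun a s₁ s₂ h h' u hu v hv _ _ _ huv => h'.2.2.1 (h u hu v hv _ _ _ huv)
  · intro a ha s₁ hf₁ hi₁ hle₁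
    have e0 : s₁.reg 0 = m := (hf₁ 0 (by decide) (by decide)).trans h0
    refine Tri.loop_mono (CloseLe gs b) (fun u s' => ∀ v < m,
      ∀ (ha : a < gs.length) (hu : u < m) (hv : v < m),
        ((⟨u, hu⟩, ⟨v, hv⟩) : Fin m × Fin m) ∈ relSet m b s →
        (gs[a] ⟨u, hu⟩, gs[a] ⟨v, hv⟩) ∈ relSet m b s') e0 (by decide) (by decide)
      (by decide) CloseLe.set CloseLe.trans ?_ ?_
    · exact fun a s₁ s₂ h h' v hv _ _ _ huv => h'.2.2.1 (h v hv _ _ _ huv)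
    · intro u hu s₂ hf₂ hi₂ hle₂
      have e0' : s₂.reg 0 = m := (hf₂ 0 (by decide) (by decide)).trans e0
      refine (Tri.loop_mono (CloseLe gs b) (fun v s' =>
        ∀ (ha : a < gs.length) (hu : u < m) (hv : v < m),
          ((⟨u, hu⟩, ⟨v, hv⟩) : Fin m × Fin m) ∈ relSet m b s →
          (gs[a] ⟨u, hu⟩, gs[a] ⟨v, hv⟩) ∈ relSet m b s') e0' (by decide)
        (by decide) (by decide) CloseLe.set CloseLe.trans ?_ ?_)
      · exact fun a s₁ s₂ h h' _ _ _ huv => h'.2.2.1 (h _ _ _ huv)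
      · intro v hv s₃ hf₃ hi₃ hle₃
        have hle := (hle₁.trans _ _ _ hle₂).trans _ _ _ hle₃
        have fr : ∀ r, r ≠ 16 → r ≠ 17 → r ≠ 18 → s₃.reg r = s.reg r := by
          intro r h1 h2 h3
          rw [hf₃ r h3 (by simp [closeStep]), hf₂ r h2 (by simp [closeStep, h3]),
            hf₁ r h1 (by simp [closeStep, h2, h3])]
        have g16 : s₃.reg 16 = a := by
          rw [hf₃ 16 (by decide) (by decide), hf₂ 16 (by decide) (by decide), hi₁]
        have g17 : s₃.reg 17 = u := by rw [hf₃ 17 (by decide) (by decide), hi₂]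
        refine (tri_closeStep (u := ⟨u, hu⟩) (v := ⟨v, hv⟩) hV ((fr 0 (by decide) (by decide)
          (by decide)).trans h0) ((fr 6 (by decide) (by decide) (by decide)).trans h6)
          ((fr 13 (by decide) (by decide) (by decide)).trans h13) (hT.congr hb hle.1) ha g16 g17
          hi₃).imp fun s' _ _ h => ⟨h.1, fun _ _ _ huv => h.2 (hle.2.2.1 huv)⟩
  · rintro s' _ _ ⟨h1, h2⟩
    refine ⟨h1, fun g hg u v huv => ?_⟩
    obtain ⟨a, ha, rfl⟩ := List.getElem_of_mem hg
    exact h2 a ha u u.2 v v.2 ha u.2 v.2 huv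

/-- A round started on a relation that is not closed adds a pair, and a closed relation stays
unchanged. So after `t` rounds the relation is closed or has at least `t` pairs, and with `m * m`
pairs it is everything, which is closed. -/
theorem tri_closeStm (hV : 1 ≤ V) (h0 : s.reg 0 = m) (h6 : s.reg 6 = b) (h13 : s.reg 13 = bg)
    (h12 : s.reg 12 = gs.length) (h14 : s.reg 14 = m * m) (hT : Table gs bg s.mem)
    (hb : bg + gs.length * m ≤ b) :
    Tri V closeStm s (fun s' => CloseLe gs b s s' ∧ ClosedUnder gs (relSet m b s')) := by
  refine Tri.loop (fun t s' => CloseLe gs b s s' ∧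
    (ClosedUnder gs (relSet m b s') ∨ t ≤ (relSet m b s').ncard)) (by decide) (by decide)
    (by decide) ⟨CloseLe.set _ _, Or.inr (Nat.zero_le _)⟩ ?_ ?_
  · rintro t - s₁ - hf hi ⟨hle, hor⟩
    refine (tri_closeRound hV ((hf 0 (by decide) (by decide)).trans h0)
      ((hf 6 (by decide) (by decide)).trans h6) ((hf 13 (by decide) (by decide)).trans h13)
      ((hf 12 (by decide) (by decide)).trans h12) (hT.congr hb hle.1) hb).imp ?_
    rintro s₂ - - ⟨hle₂, hround⟩
    refine ⟨(hle.trans _ _ _ hle₂).trans _ _ _ (CloseLe.set _ _), ?_⟩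
    rw [relSet_congr (St.set_mem _ _ _)]
    by_cases hcl : ClosedUnder gs (relSet m b s₁)
    · left
      rwa [subset_antisymm (hle₂.2.2.2 _ hcl subset_rfl) hle₂.2.2.1]
    · right
      have hcard := hor.resolve_left hcl
      refine lt_of_le_of_lt hcard (Set.ncard_lt_ncard ⟨hle₂.2.2.1, fun hsub => hcl ?_⟩
        (Set.toFinite _))
      exact fun g hg u v huv => hsub (hround g hg u v huv)
  · rintro s' ⟨hle, hor⟩
    refine ⟨hle, hor.elim id fun hcard => ?_⟩
    have : relSet m b s' = Set.univ := by
      refine Set.eq_of_subset_of_ncard_le (Set.subset_univ _) ?_ (Set.toFinite _)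
      rw [Set.ncard_univ]
      simpa [h14] using hcard
    rw [this]
    exact fun _ _ _ _ _ => Set.mem_univ _

end Closure

/-! ### Recognition of injective partial functions -/

/-- Detect a violation of injectivity or functionality at the given triple. -/
def checkStep : Stm :=
  .ite (.add
      (.mul (.mul (.load (cell (.reg 17) (.reg 18))) (.load (cell (.reg 17) (.reg 19))))
        (dist (.reg 18) (.reg 19)))
      (.mul (.mul (.load (cell (.reg 18) (.reg 17))) (.load (cell (.reg 19) (.reg 17))))
        (dist (.reg 18) (.reg 19))))
    (.set 10 (.const 1)) .skip

/-- Make register `10` zero iff the relation is an injective partial function. -/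
def checkStm : Stm := .seq (.set 10 (.const 0)) (.loop 17 0 (.loop 18 0 (.loop 19 0 checkStep)))

/-- The transitions that occur during the check. -/
def CheckLe (m b : ℕ) (s s' : St) : Prop :=
  s'.mem = s.mem ∧ s'.buf = s.buf ∧ (s.reg 10 ≠ 0 → s'.reg 10 ≠ 0) ∧
    (s'.reg 10 ≠ 0 → s.reg 10 ≠ 0 ∨ ¬ PartialInj (relSet m b s))

theorem CheckLe.trans {m b : ℕ} (s₁ s₂ s₃ : St) (h : CheckLe m b s₁ s₂) (h' : CheckLe m b s₂ s₃) :
    CheckLe m b s₁ s₃ := by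
  refine ⟨h'.1.trans h.1, h'.2.1.trans h.2.1, fun h1 => h'.2.2.1 (h.2.2.1 h1), fun h1 => ?_⟩
  rcases h'.2.2.2 h1 with h2 | h2
  · exact h.2.2.2 h2
  · rw [relSet_congr h.1] at h2
    exact Or.inr h2

theorem CheckLe.set {m b i : ℕ} (hi : 10 ≠ i) (s : St) (j : ℕ) : CheckLe m b s (s.set i j) := by
  refine ⟨rfl, rfl, ?_, ?_⟩ <;> rw [St.set_reg, if_neg hi]
  exacts [fun h => h, fun h => Or.inl h]

/-- The triples that `checkStep` looks for. -/
def Violation {m : ℕ} (S : Set (Fin m × Fin m)) (u v w : Fin m) : Prop :=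
  v ≠ w ∧ ((u, v) ∈ S ∧ (u, w) ∈ S ∨ (v, u) ∈ S ∧ (w, u) ∈ S)

section Check

variable {V m b : ℕ} {s : St}

theorem tri_checkStep (hV : 1 ≤ V) (h0 : s.reg 0 = m) (h6 : s.reg 6 = b) {u v w : Fin m}
    (h17 : s.reg 17 = u) (h18 : s.reg 18 = v) (h19 : s.reg 19 = w) :
    Tri V checkStep s (fun s' => CheckLe m b s s' ∧
      (Violation (relSet m b s) u v w → s'.reg 10 ≠ 0)) := by
  have hd : (v : ℕ) - w + (w - v) = 0 ↔ v = w := by rw [Fin.ext_iff]; omega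
  refine Tri.ite (fun h => Tri.set hV ⟨⟨rfl, rfl, ?_, fun _ => Or.inr fun hinj => h ?_⟩, ?_⟩)
    (fun h => Tri.skip ⟨⟨rfl, rfl, id, Or.inl⟩, ?_⟩)
  · simp
  · simp only [Expr.val, cell, dist, h0, h6, h17, h18, h19, Nat.add_eq_zero_iff,
      Nat.mul_eq_zero]
    rw [← Nat.add_eq_zero_iff, hd]
    have := hinj u v w
    simp only [mem_relSet] at this
    tauto
  · simp
  · rintro ⟨h1, h2⟩
    simp only [Expr.val, cell, dist, h0, h6, h17, h18, h19, Nat.add_eq_zero_iff (n := _ * _),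
      Nat.mul_eq_zero, hd] at h
    simp only [mem_relSet] at h2
    tauto

theorem tri_checkStm (hV : 1 ≤ V) (h0 : s.reg 0 = m) (h6 : s.reg 6 = b) :
    Tri V checkStm s (fun s' => s'.mem = s.mem ∧ s'.buf = s.buf ∧
      (s'.reg 10 = 0 ↔ PartialInj (relSet m b s))) := by
  refine Tri.seq (Tri.set (Nat.zero_le _) ?_)
  set S := relSet m b s with hS
  simp only [Expr.val]
  set s₀ := s.set 10 0 with hs₀
  have e₀ : s₀.reg 0 = m := by simp [hs₀, h0]
  refine (Tri.loop_mono (CheckLe m b) (fun u s' => ∀ v < m, ∀ w < m,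
    ∀ (hu : u < m) (hv : v < m) (hw : w < m), Violation S ⟨u, hu⟩ ⟨v, hv⟩ ⟨w, hw⟩ →
      s'.reg 10 ≠ 0) e₀ (by decide) (by decide) (by decide) (CheckLe.set (by decide)) CheckLe.trans
    (fun _ _ _ h h' v hv w hw _ _ _ hx => h'.2.2.1 (h v hv w hw _ _ _ hx)) ?_).imp ?_
  · intro u hu s₁ hf₁ hi₁ hle₁
    have e₁ : s₁.reg 0 = m := (hf₁ 0 (by decide) (by decide)).trans e₀
    refine Tri.loop_mono (CheckLe m b) (fun v s' => ∀ w < m,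
      ∀ (hu : u < m) (hv : v < m) (hw : w < m), Violation S ⟨u, hu⟩ ⟨v, hv⟩ ⟨w, hw⟩ →
        s'.reg 10 ≠ 0) e₁ (by decide) (by decide) (by decide) (CheckLe.set (by decide)) CheckLe.trans
      (fun _ _ _ h h' w hw _ _ _ hx => h'.2.2.1 (h w hw _ _ _ hx)) ?_
    intro v hv s₂ hf₂ hi₂ hle₂
    have e₂ : s₂.reg 0 = m := (hf₂ 0 (by decide) (by decide)).trans e₁
    refine Tri.loop_mono (CheckLe m b) (fun w s' =>
      ∀ (hu : u < m) (hv : v < m) (hw : w < m), Violation S ⟨u, hu⟩ ⟨v, hv⟩ ⟨w, hw⟩ →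
        s'.reg 10 ≠ 0) e₂ (by decide) (by decide) (by decide) (CheckLe.set (by decide)) CheckLe.trans
      (fun _ _ _ h h' _ _ _ hx => h'.2.2.1 (h _ _ _ hx)) ?_
    intro w hw s₃ hf₃ hi₃ hle₃
    have hle := (hle₁.trans _ _ _ hle₂).trans _ _ _ hle₃
    have g6 : s₃.reg 6 = b := by
      rw [hf₃ 6 (by decide) (by decide), hf₂ 6 (by decide) (by decide),
        hf₁ 6 (by decide) (by decide)]
      simpa [hs₀] using h6
    have g17 : s₃.reg 17 = u := by
      rw [hf₃ 17 (by decide) (by decide), hf₂ 17 (by decide) (by decide), hi₁]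
    have g18 : s₃.reg 18 = v := by rw [hf₃ 18 (by decide) (by decide), hi₂]
    refine (tri_checkStep (u := ⟨u, hu⟩) (v := ⟨v, hv⟩) (w := ⟨w, hw⟩) hV
      ((hf₃ 0 (by decide) (by decide)).trans e₂) g6 g17 g18 hi₃).imp ?_
    rintro s' - - ⟨h1, h2⟩
    rw [relSet_congr hle.1] at h2
    exact ⟨h1, fun _ _ _ => h2⟩
  · rintro s' - - ⟨hle, hall⟩
    refine ⟨hle.1, hle.2.1, fun h u v w => ?_, fun h => ?_⟩
    · have := hall u u.2 v v.2 w w.2 u.2 v.2 w.2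
      simp only [h, Violation] at this
      tauto
    · by_contra h10
      rcases hle.2.2.2 h10 with h1 | h1
      · simp [hs₀] at h1
      · exact h1 h

end Check

/-! ### Compatibility of prescribed values -/

/-- Make the relation empty. -/
def clearStm : Stm := .loop 18 14 (.store (.add (.reg 6) (.reg 18)) (.const 0))

/-- Store the relation that consists of the pairs `(x i, F i)` for `i` below the content of
register `22`, where `F` is the stored partial map, and the pair of `p` and register `8`.
The index `i` stands in register `18`. -/
def seedStm (x p : Expr) : Stm :=
  .seq clearStm (.seq (.loop 18 22 (.store (cell x (mapVal (.reg 18))) (.const 1)))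
    (.store (cell p (.reg 8)) (.const 1)))

/-- Decide whether some permutation commutes with the generators in the given table and contains
the relation that consists of the pairs described at `seedStm`; zero in register `10` means yes. -/
def tryStm (x p base cnt : Expr) : Stm :=
  .seq (seedStm x p) (.seq (.set 13 base) (.seq (.set 12 cnt) (.seq closeStm checkStm)))

section Seed

variable {V m b : ℕ} {s : St}

theorem tri_clearStm (h6 : s.reg 6 = b) (h14 : s.reg 14 = m * m) :
    Tri V clearStm s (fun s' => (∀ a < b, s'.mem a = s.mem a) ∧ s'.buf = s.buf ∧
      relSet m b s' = ∅) := by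
  refine (Tri.loop_mono (fun s s' => (∀ a < b, s'.mem a = s.mem a) ∧ s'.buf = s.buf ∧
    ∀ a, s.mem a = 0 → s'.mem a = 0) (fun j s' => s'.mem (b + j) = 0) h14 (by decide)
    (by decide) (by decide) (fun _ _ => ⟨fun _ _ => rfl, rfl, fun _ h => h⟩)
    (fun s₁ s₂ s₃ h h' => ⟨fun a ha => (h'.1 a ha).trans (h.1 a ha), h'.2.1.trans h.2.1,
      fun a ha => h'.2.2 a (h.2.2 a ha)⟩) (fun j s₁ s₂ h h' => h'.2.2 _ h) ?_).imp ?_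
  · intro j _ s₁ hf hi _
    have g6 : s₁.reg 6 = b := (hf 6 (by decide) (by decide)).trans h6
    refine Tri.store (Nat.zero_le _) ⟨⟨fun a ha => ?_, rfl, fun a ha => ?_⟩, ?_⟩
    · simp only [Expr.val, St.put_mem, g6]
      rw [if_neg (by omega)]
    · simp [ha]
    · simp [g6, hi]
  · rintro s' - - ⟨h1, h2⟩
    refine ⟨h1.1, h1.2.1, ?_⟩
    ext ⟨u, v⟩
    rw [mem_relSet]
    have := h2 (u * m + v) (mul_add_lt u.2 v.2)
    simp [this]

variable {x p : Expr} {k bF : ℕ} {F X : Fin m → Fin m} {y z : Fin m}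

/-- The expressions `x` and `p` are evaluated after the matrix and register `18` have changed, so
their values are required in all such states. -/
theorem tri_seedStm (hV : 1 ≤ V) (h0 : s.reg 0 = m) (h6 : s.reg 6 = b) (h14 : s.reg 14 = m * m)
    (h5 : s.reg 5 = bF) (hbF : bF + 1 + m ≤ b) (h22 : s.reg 22 = k) (hk : k ≤ m)
    (hF : ∀ i : Fin m, i.val < k → s.mem (bF + 1 + i) = F i) (h8 : s.reg 8 = y)
    (hx : ∀ s' : St, (∀ a < b, s'.mem a = s.mem a) → (∀ r, r ≠ 18 → s'.reg r = s.reg r) →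
      ∀ i : Fin m, i.val < k → s'.reg 18 = i → x.val s' = X i)
    (hp : ∀ s' : St, (∀ r, r ≠ 18 → s'.reg r = s.reg r) → p.val s' = z) :
    Tri V (seedStm x p) s (fun s' => (∀ a < b, s'.mem a = s.mem a) ∧ s'.buf = s.buf ∧
      relSet m b s' = {q | (∃ i : Fin m, i.val < k ∧ q = (X i, F i)) ∨ q = (z, y)}) := by
  refine Tri.seq ((tri_clearStm h6 h14).imp ?_)
  rintro s₁ - hf₁ ⟨hm₁, hb₁, hr₁⟩
  have f₁ : ∀ r, r ≠ 18 → s₁.reg r = s.reg r := fun r hr => hf₁ r (by simpa [clearStm] using hr)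
  set S : Set (Fin m × Fin m) := {q | ∃ i : Fin m, i.val < k ∧ q = (X i, F i)} with hS
  refine Tri.seq ((Tri.loop_mono (fun s s' => (∀ a < b, s'.mem a = s.mem a) ∧ s'.buf = s.buf ∧
    relSet m b s ⊆ relSet m b s' ∧ (relSet m b s ⊆ S → relSet m b s' ⊆ S))
    (fun j s' => ∀ h : j < m, (X ⟨j, h⟩, F ⟨j, h⟩) ∈ relSet m b s')
    ((f₁ 22 (by decide)).trans h22) (by simp) (by simp) (by decide)
    (fun _ _ => ⟨fun _ _ => rfl, rfl, subset_rfl, fun h => h⟩)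
    (fun s₁ s₂ s₃ h h' => ⟨fun a ha => (h'.1 a ha).trans (h.1 a ha), h'.2.1.trans h.2.1,
      h.2.2.1.trans h'.2.2.1, fun hs => h'.2.2.2 (h.2.2.2 hs)⟩)
    (fun j s₁ s₂ h h' hj => h'.2.2.1 (h hj)) ?_).imp ?_)
  · intro j hj s₂ hf₂ hi₂ hle
    have f₂ : ∀ r, r ≠ 18 → s₂.reg r = s.reg r := fun r hr =>
      (hf₂ r hr (by simp)).trans (f₁ r hr)
    have hm₂ : ∀ a < b, s₂.mem a = s.mem a := fun a ha => (hle.1 a ha).trans (hm₁ a ha)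
    have hjm : j < m := by omega
    refine Tri.store hV ?_
    have hxv := hx s₂ hm₂ f₂ ⟨j, hjm⟩ hj hi₂
    have hFv := hF ⟨j, hjm⟩ hj
    rw [← hm₂ _ (by simp only; omega)] at hFv
    have hcell : (cell x (mapVal (.reg 18))).val s₂ =
        b + ((X ⟨j, hjm⟩ : Fin m) * m + (F ⟨j, hjm⟩ : Fin m)) := by
      simp only [cell, mapVal, Expr.val, f₂ 6 (by decide), f₂ 0 (by decide), f₂ 5 (by decide),
        h0, h6, h5, hxv, hi₂]
      rw [hFv]
    rw [hcell]
    simp only [Expr.val, relSet_put]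
    refine ⟨⟨fun a ha => ?_, rfl, Set.subset_insert _ _, fun hs => Set.insert_subset
      ⟨⟨j, hjm⟩, hj, rfl⟩ hs⟩, fun _ => Set.mem_insert _ _⟩
    rw [St.put_mem, if_neg (by omega)]
  · rintro s₂ - hf₂ ⟨hle, hall⟩
    have f₂ : ∀ r, r ≠ 18 → s₂.reg r = s.reg r := fun r hr =>
      (hf₂ r (by simpa using hr)).trans (f₁ r hr)
    have hrel : relSet m b s₂ = S := by
      refine subset_antisymm (hle.2.2.2 (by rw [hr₁]; exact Set.empty_subset _)) ?_
      rintro _ ⟨i, hi, rfl⟩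
      exact hall i hi i.2
    refine Tri.store hV ?_
    have hcell : (cell p (.reg 8)).val s₂ = b + ((z : Fin m) * m + (y : Fin m)) := by
      simp only [cell, Expr.val, f₂ 6 (by decide), f₂ 0 (by decide), f₂ 8 (by decide), h0, h6, h8,
        hp s₂ f₂]
    rw [hcell]
    simp only [Expr.val, relSet_put, hrel]
    refine ⟨fun a ha => ?_, hle.2.1.trans hb₁, ?_⟩
    · rw [St.put_mem, if_neg (by omega), hle.1 a ha, hm₁ a ha]
    · ext q
      simp only [hS, Set.mem_insert_iff, Set.mem_ofPred_eq]
      exact or_comm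

/-- The closure loop yields the least closed relation above the seeded pairs, so
`partialInj_closure_iff` turns the final check into the existence of the permutation. -/
theorem tri_tryStm {gs : List (Perm (Fin m))} {bg : ℕ} {base cnt : Expr}
    (hV : 1 ≤ V) (h0 : s.reg 0 = m) (h6 : s.reg 6 = b) (h14 : s.reg 14 = m * m)
    (h5 : s.reg 5 = bF) (hbF : bF + 1 + m ≤ b) (h22 : s.reg 22 = k) (hk : k ≤ m)
    (hF : ∀ i : Fin m, i.val < k → s.mem (bF + 1 + i) = F i) (h8 : s.reg 8 = y)
    (hx : ∀ s' : St, (∀ a < b, s'.mem a = s.mem a) → (∀ r, r ≠ 18 → s'.reg r = s.reg r) →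
      ∀ i : Fin m, i.val < k → s'.reg 18 = i → x.val s' = X i)
    (hp : ∀ s' : St, (∀ r, r ≠ 18 → s'.reg r = s.reg r) → p.val s' = z)
    (hbase : ∀ s' : St, (∀ r, r ≠ 18 → s'.reg r = s.reg r) → base.val s' = bg)
    (hcnt : ∀ s' : St, (∀ r, r ≠ 18 → r ≠ 13 → s'.reg r = s.reg r) → cnt.val s' = gs.length)
    (hbgV : bg ≤ V) (hcV : gs.length ≤ V) (hT : Table gs bg s.mem)
    (hb : bg + gs.length * m ≤ b) :
    Tri V (tryStm x p base cnt) s (fun s' => (∀ a < b, s'.mem a = s.mem a) ∧ s'.buf = s.buf ∧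
      (s'.reg 10 = 0 ↔ ∃ l : Perm (Fin m), (∀ g ∈ gs, Commute l g) ∧
        (∀ i : Fin m, i.val < k → l (X i) = F i) ∧ l z = y)) := by
  refine Tri.seq ((tri_seedStm hV h0 h6 h14 h5 hbF h22 hk hF h8 hx hp).imp ?_)
  rintro s₁ - hf₁ ⟨hm₁, hb₁, hr₁⟩
  have f₁ : ∀ r, r ≠ 18 → s₁.reg r = s.reg r := fun r hr =>
    hf₁ r (by simpa [seedStm, clearStm] using hr)
  have hbv := hbase s₁ f₁
  refine Tri.seq (Tri.set (by omega) (Tri.seq ?_))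
  rw [hbv]
  have hcv := hcnt (s₁.set 13 bg) (fun r h1 h2 => by rw [St.set_reg, if_neg h2, f₁ r h1])
  refine Tri.set (by omega) (Tri.seq ?_)
  rw [hcv]
  set s₂ := (s₁.set 13 bg).set 12 gs.length with hs₂
  have f₂ : ∀ r, r ≠ 18 → r ≠ 13 → r ≠ 12 → s₂.reg r = s.reg r := by
    intro r h1 h2 h3
    rw [hs₂, St.set_reg, if_neg h3, St.set_reg, if_neg h2, f₁ r h1]
  have g0 : s₂.reg 0 = m := (f₂ 0 (by decide) (by decide) (by decide)).trans h0
  have g6 : s₂.reg 6 = b := (f₂ 6 (by decide) (by decide) (by decide)).trans h6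
  refine (tri_closeStm hV g0 g6 (by simp [hs₂]) (by simp [hs₂])
    ((f₂ 14 (by decide) (by decide) (by decide)).trans h14) (hT.congr hb hm₁) hb).imp ?_
  rintro s₃ - hf₃ ⟨hle, hcl⟩
  refine (tri_checkStm hV ((hf₃ 0 (by decide)).trans g0) ((hf₃ 6 (by decide)).trans g6)).imp ?_
  rintro s₄ - - ⟨hm₄, hb₄, hiff⟩
  refine ⟨fun a ha => ?_, hb₄.trans (hle.2.1.trans hb₁), ?_⟩
  · rw [hm₄, hle.1 a ha]
    exact hm₁ a ha
  · rw [hiff, partialInj_closure_iff hcl hle.2.2.1 hle.2.2.2]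
    have hrel : relSet m b s₂ = relSet m b s₁ := rfl
    rw [hrel, hr₁]
    refine exists_congr fun l => and_congr_right fun _ => ?_
    constructor
    · exact fun h => ⟨fun i hi => h _ _ (Or.inl ⟨i, hi, rfl⟩), h _ _ (Or.inr rfl)⟩
    · rintro ⟨h1, h2⟩ u v (⟨i, hi, huv⟩ | huv)
      · obtain ⟨rfl, rfl⟩ := Prod.mk.inj huv
        exact h1 i hi
      · obtain ⟨rfl, rfl⟩ := Prod.mk.inj huv
        exact h2

end Seed

/-- Decide whether the value in register `8` can come next; nonzero in register `9` means yes. -/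
def testStm : Stm :=
  .seq (tryStm (.reg 18) (.reg 22) (.reg 3) (.reg 1))
    (.seq (.set 9 (.sub (.const 1) (.reg 10)))
      (.loop 11 8 (.seq (tryStm (mapVal (.reg 18)) (.reg 11) (.reg 4) (.reg 2))
        (.ite (.reg 10) .skip (.set 9 (.const 0))))))

/-- These are the two conditions of `canon_step`. Compatibility takes one trial with the first
table; minimality takes one trial with the second table for each `z` below `y`, where the pairs `(F
i, F i)` express that the previous values are fixed. -/
theorem tri_testStm {V m b : ℕ} {s : St} {bF bA bB : ℕ} {F : Fin m → Fin m} {k y : Fin m}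
    {gA gB : List (Perm (Fin m))} (hV : 1 ≤ V) (h0 : s.reg 0 = m) (h6 : s.reg 6 = b)
    (h14 : s.reg 14 = m * m)
    (h5 : s.reg 5 = bF) (hbF : bF + 1 + m ≤ b) (h22 : s.reg 22 = k)
    (hF : ∀ i < k, s.mem (bF + 1 + i) = F i) (h8 : s.reg 8 = y)
    (h3 : s.reg 3 = bA) (h1 : s.reg 1 = gA.length) (hTA : Table gA bA s.mem)
    (hA : bA + gA.length * m ≤ b)
    (h4 : s.reg 4 = bB) (h2 : s.reg 2 = gB.length) (hTB : Table gB bB s.mem)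
    (hB : bB + gB.length * m ≤ b) :
    Tri V testStm s (fun s' => (∀ a < b, s'.mem a = s.mem a) ∧ s'.buf = s.buf ∧
      (s'.reg 9 ≠ 0 ↔
        (∃ l : Perm (Fin m), (∀ g ∈ gA, Commute l g) ∧ (∀ i < k, l i = F i) ∧ l k = y) ∧
        ∀ z < y, ¬ ∃ l : Perm (Fin m), (∀ g ∈ gB, Commute l g) ∧ (∀ i < k, l (F i) = F i) ∧
          l z = y)) := by
  refine Tri.of_bdd fun hbdd => Tri.seq ((tri_tryStm (x := .reg 18) (p := .reg 22)
    (base := .reg 3) (cnt := .reg 1) (X := fun i => i) (z := k) (bg := bA)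
    (gs := gA) hV h0 h6 h14 h5 hbF h22 k.2.le hF h8 (fun s' _ _ i _ h => h)
    (fun s' hf => (hf 22 (by decide)).trans h22) (fun s' hf => (hf 3 (by decide)).trans h3)
    (fun s' hf => (hf 1 (by decide) (by decide)).trans h1) (h3 ▸ hbdd.reg 3) (h1 ▸ hbdd.reg 1)
    hTA hA).imp ?_)
  rintro s₁ - hf₁ ⟨hm₁, hb₁, hiff₁⟩
  -- Truncated subtraction from 1 negates the flag.
  have hv9 : 1 - s₁.reg 10 ≠ 0 ↔ s₁.reg 10 = 0 := by omega
  refine Tri.seq (Tri.set (by simp only [Expr.val]; omega) ?_)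
  simp only [Expr.val]
  set s₂ := s₁.set 9 (1 - s₁.reg 10) with hs₂
  have f₂ : ∀ r, r ≠ 9 → r ∉ testStm.writes → s₂.reg r = s.reg r := by
    intro r h9 hr
    rw [hs₂, St.set_reg, if_neg h9]
    refine hf₁ r fun h => hr ?_
    simp only [testStm, Stm.writes]
    exact List.mem_append_left _ h
  refine (Tri.loop (fun j s' => (∀ a < b, s'.mem a = s.mem a) ∧ s'.buf = s.buf ∧
      (s'.reg 9 ≠ 0 ↔ s₁.reg 10 = 0 ∧ ∀ z : Fin m, z.val < j →
        ¬ ∃ l : Perm (Fin m), (∀ g ∈ gB, Commute l g) ∧ (∀ i < k, l (F i) = F i) ∧ l z = y))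
    (by decide) (by decide) (by decide) ⟨hm₁, hb₁, ?_⟩ ?_ ?_)
  · simp [hs₂, hv9]
  · rintro j hj s₃ hbdd₃ hf₃ hi₃ ⟨hm₃, hb₃, hiff₃⟩
    have f₃ : ∀ r, r ∉ testStm.writes → s₃.reg r = s.reg r := by
      intro r hr
      have h9 : r ≠ 9 := by rintro rfl; exact hr (by decide)
      have h11 : r ≠ 11 := by rintro rfl; exact hr (by decide)
      refine (hf₃ r h11 fun h => hr ?_).trans (f₂ r h9 hr)
      simp only [testStm, Stm.writes] at h ⊢
      exact List.mem_append_right _ (List.mem_append_right _ (List.mem_cons_of_mem _ h))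
    rw [f₂ 8 (by decide) (by decide), h8] at hj
    have hjm : j < m := hj.trans y.2
    refine Tri.seq ((tri_tryStm (x := mapVal (.reg 18)) (p := .reg 11)
      (base := .reg 4) (cnt := .reg 2) (X := F) (z := ⟨j, hjm⟩) (bg := bB) (gs := gB) (b := b) (bF := bF)
      (k := k) (F := F) (y := y) hV
      ((f₃ 0 (by decide)).trans h0) ((f₃ 6 (by decide)).trans h6)
      ((f₃ 14 (by decide)).trans h14) ((f₃ 5 (by decide)).trans h5) hbF
      ((f₃ 22 (by decide)).trans h22) k.2.le
      (fun i hi => by rw [hm₃ _ (by omega), hF i hi]) ((f₃ 8 (by decide)).trans h8)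
      ?_ (fun s' hf => (hf 11 (by decide)).trans hi₃)
      (fun s' hf => (hf 4 (by decide)).trans ((f₃ 4 (by decide)).trans h4))
      (fun s' hf => (hf 2 (by decide) (by decide)).trans ((f₃ 2 (by decide)).trans h2))
      (h4 ▸ hbdd.reg 4) (h2 ▸ hbdd.reg 2) (hTB.congr hB hm₃) hB).imp ?_)
    · intro s' hm hf i hi h18
      have e5 : s'.reg 5 = bF := (hf 5 (by decide)).trans ((f₃ 5 (by decide)).trans h5)
      simp only [mapVal, Expr.val, e5, h18]
      rw [hm _ (by omega), hm₃ _ (by omega), hF i hi]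
    · rintro s₄ - hf₄ ⟨hm₄, hb₄, hiff₄⟩
      have e9 : s₄.reg 9 = s₃.reg 9 := hf₄ 9 (by decide)
      refine Tri.ite (fun h => Tri.skip ?_) (fun h => Tri.set (Nat.zero_le _) ?_)
      · refine ⟨fun a ha => (hm₄ a ha).trans (hm₃ a ha), hb₄.trans hb₃, ?_⟩
        rw [St.set_reg, if_neg (by decide), e9, hiff₃]
        refine and_congr_right fun _ => ⟨fun hall z hz => ?_, fun hall z hz => hall z (by omega)⟩
        rcases Nat.lt_succ_iff_lt_or_eq.1 hz with hz | hz
        · exact hall z hz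
        · obtain rfl : z = ⟨j, hjm⟩ := Fin.ext hz
          exact fun hex => h (hiff₄.2 hex)
      · refine ⟨fun a ha => (hm₄ a ha).trans (hm₃ a ha), hb₄.trans hb₃, ?_⟩
        simp only [Expr.val, St.set_reg]
        simp only [show (9 : ℕ) ≠ 11 by decide, if_false, if_true, ne_eq, not_true, false_iff]
        rintro ⟨-, hall⟩
        exact hall ⟨j, hjm⟩ (Nat.lt_succ_self j) (hiff₄.1 h)
  · rintro s' ⟨hm, hb, hiff⟩
    rw [f₂ 8 (by decide) (by decide), h8] at hiff
    refine ⟨hm, hb, ?_⟩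
    rw [hiff, hiff₁]
    rfl

/-! ### Output -/

/-- Write the values of the conjugates of the generators in the second table by the stored
permutation. -/
def outStm : Stm :=
  .loop 16 2 (.loop 17 0 (.seq (.loop 18 0
    (.ite (dist (mapVal (.reg 18))
        (.load (.add (.reg 4) (.add (.mul (.reg 16) (.reg 0)) (mapVal (.reg 17))))))
      .skip (.set 19 (.reg 18)))) (.write (.reg 19))))

/-- No inverse of `l` is computed: the value of the conjugate at `u` is the unique `w` with `l w = g
(l u)`, found by trying all points and kept in register `19`. -/
theorem tri_outStm {V m : ℕ} {s : St} {bF bB : ℕ} {l : Perm (Fin m)} {gB : List (Perm (Fin m))}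
    (h0 : s.reg 0 = m) (h5 : s.reg 5 = bF)
    (hF : ∀ i : Fin m, s.mem (bF + 1 + i) = l i)
    (h4 : s.reg 4 = bB) (h2 : s.reg 2 = gB.length) (hTB : Table gB bB s.mem) :
    Tri V outStm s (fun s' => s'.mem = s.mem ∧
      s'.buf = s.buf ++ gB.flatMap fun g => permCode (l⁻¹ * g * l)) := by
  refine Tri.loop (fun a s' => s'.mem = s.mem ∧
      s'.buf = s.buf ++ (gB.take a).flatMap fun g => permCode (l⁻¹ * g * l))
    (by decide) (by decide) (by decide) ⟨rfl, by simp⟩ ?_ (fun s' h => by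
      rwa [h2, List.take_length] at h)
  rintro a ha s₁ - hf₁ hi₁ ⟨hm₁, hb₁⟩
  rw [h2] at ha
  have e₁ : s₁.reg 0 = m := (hf₁ 0 (by decide) (by decide)).trans h0
  refine Tri.loop (fun u s' => s'.mem = s.mem ∧
      s'.buf = s₁.buf ++ (permCode (l⁻¹ * gB[a] * l)).take u)
    (by decide) (by decide) (by decide) ⟨hm₁, by simp⟩ ?_ ?_
  · rintro u hu s₂ hbdd₂ hf₂ hi₂ ⟨hm₂, hb₂⟩
    rw [e₁] at hu
    have e₂ : s₂.reg 0 = m := (hf₂ 0 (by decide) (by decide)).trans e₁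
    set w : Fin m := (l⁻¹ * gB[a] * l) ⟨u, hu⟩ with hw
    have hlw : l w = gB[a] (l ⟨u, hu⟩) := by simp [hw]
    refine Tri.seq ((Tri.loop (Q := fun s' => s'.mem = s.mem ∧ s'.buf = s₂.buf ∧ s'.reg 19 = w)
      (fun j s' => s'.mem = s.mem ∧ s'.buf = s₂.buf ∧
      (w.val < j → s'.reg 19 = w)) (by decide) (by decide) (by decide)
      ⟨hm₂, rfl, fun h => absurd h (Nat.not_lt_zero _)⟩ ?_ ?_).imp ?_)
    · rintro j hj s₃ hbdd₃ hf₃ hi₃ ⟨hm₃, hb₃, hw₃⟩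
      rw [e₂] at hj
      have g5 : s₃.reg 5 = bF := by
        rw [hf₃ 5 (by decide) (by decide), hf₂ 5 (by decide) (by decide),
          hf₁ 5 (by decide) (by decide), h5]
      have g4 : s₃.reg 4 = bB := by
        rw [hf₃ 4 (by decide) (by decide), hf₂ 4 (by decide) (by decide),
          hf₁ 4 (by decide) (by decide), h4]
      have g0 : s₃.reg 0 = m := (hf₃ 0 (by decide) (by decide)).trans e₂
      have g16 : s₃.reg 16 = a := by
        rw [hf₃ 16 (by decide) (by decide), hf₂ 16 (by decide) (by decide), hi₁]
      have g17 : s₃.reg 17 = u := by rw [hf₃ 17 (by decide) (by decide), hi₂]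
      have hFu := hF ⟨u, hu⟩
      have hFj := hF ⟨j, hj⟩
      have hval : (dist (mapVal (.reg 18)) (.load (.add (.reg 4)
          (.add (.mul (.reg 16) (.reg 0)) (mapVal (.reg 17)))))).val s₃ = 0 ↔ w.val = j := by
        simp only [dist, mapVal, Expr.val, g5, g4, g0, g16, g17, hi₃, hm₃]
        simp only at hFu hFj
        rw [hFu, hFj, hTB a ha, ← hlw]
        constructor
        · intro h
          have h' : l ⟨j, hj⟩ = l w := Fin.ext (by omega)
          rw [← l.injective h']
        · rintro h
          have : w = ⟨j, hj⟩ := Fin.ext h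
          rw [this]
          omega
      refine Tri.ite (fun h => Tri.skip ⟨hm₃, hb₃, fun hlt => ?_⟩)
        (fun h => Tri.set (hbdd₃.reg 18) ⟨hm₃, hb₃, fun _ => ?_⟩)
      · rw [St.set_reg, if_neg (by decide)]
        refine hw₃ (lt_of_le_of_ne (Nat.lt_succ_iff.1 hlt) fun heq => h (hval.2 heq))
      · simp only [Expr.val, St.set_reg]
        simp [hi₃, hval.1 h]
    · rintro s' ⟨h1, h2, h3⟩
      exact ⟨h1, h2, h3 (e₂ ▸ w.2)⟩
    · rintro s₃ - - ⟨hm₃, hb₃, hw₃⟩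
      refine Tri.write ⟨hm₃, ?_⟩
      simp only [St.set_buf, Expr.val, hb₃, hb₂, hw₃]
      have hlen : u < (permCode (l⁻¹ * gB[a] * l)).length := by simpa [permCode] using hu
      rw [List.take_succ_eq_append_getElem hlen, ← List.append_assoc]
      simp [permCode, hw]
  · rintro s₂ ⟨hm₂, hb₂⟩
    refine ⟨hm₂, ?_⟩
    have hlen : (permCode (l⁻¹ * gB[a] * l)).length = m := by simp [permCode]
    rw [e₁, List.take_of_length_le hlen.le] at hb₂
    rw [St.set_buf, hb₂, hb₁, List.take_succ_eq_append_getElem ha, List.flatMap_append]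
    simp

/-! ### The search program -/

/-- Return to the previous position, and go to the next value there. -/
def backStm : Stm :=
  .seq (.set 7 (.sub (.reg 7) (.const 1)))
    (.set 8 (.add (.load (.add (.reg 5) (.reg 7))) (.const 1)))

/-- Try the value in register `8`. -/
def advanceStm : Stm :=
  .seq (.set 22 (.sub (.reg 7) (.const 1))) (.seq testStm
    (.ite (.reg 9)
      (.seq (.store (.add (.reg 5) (.reg 7)) (.reg 8))
        (.seq (.set 7 (.add (.reg 7) (.const 1))) (.set 8 (.const 0))))
      (.set 8 (.add (.reg 8) (.const 1)))))

/-- One step of the depth-first search. Register `7` holds the depth plus one, and register `8` the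
next value to be tried. Register `20` becomes nonzero if an output item has been completed. -/
def bodyStm : Stm :=
  .seq (.set 20 (.const 0))
    (.ite (.sub (.add (.reg 0) (.const 1)) (.reg 7))
      (.ite (.sub (.reg 0) (.reg 8)) advanceStm backStm)
      (.seq outStm (.seq (.set 20 (.const 1)) backStm)))

/-- Read the degrees and compute the addresses. -/
def setupStm : Stm :=
  .seq (.set 21 (.load (.const 0))) (.seq (.set 0 (.load (.const 1)))
    (.seq (.set 1 (.load (.const 2))) (.seq (.set 2 (.load (.const 3)))
      (.seq (.set 3 (.add (.const 4) (.mul (.reg 1) (.reg 21))))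
        (.seq (.set 4 (.add (.reg 3) (.add (.mul (.reg 1) (.reg 0)) (.mul (.reg 2) (.reg 21)))))
          (.seq (.set 5 (.add (.reg 4) (.mul (.reg 2) (.reg 0))))
            (.seq (.set 6 (.add (.add (.reg 5) (.const 1)) (.reg 0)))
              (.seq (.set 14 (.mul (.reg 0) (.reg 0)))
                (.seq (.set 7 (.const 1)) (.set 8 (.const 0)))))))))))

/-- The loop of the search. -/
def searchLoop : Prog := .loop (2 * 7) (.seq bodyStm.code (.branch (2 * 20) (.instr .deliver) .skip))

/-- The program that lists the equivalent extensions. -/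
def enumProg : Prog := .seq setupStm.code searchLoop

/-- The group of the permutations that commute with all members of the list. -/
def commGroup {m : ℕ} (gs : List (Perm (Fin m))) : Subgroup (Perm (Fin m)) :=
  Subgroup.centralizer {g | g ∈ gs}

theorem mem_commGroup {m : ℕ} {gs : List (Perm (Fin m))} {l : Perm (Fin m)} :
    l ∈ commGroup gs ↔ ∀ g ∈ gs, Commute l g := by
  rw [commGroup, Subgroup.mem_centralizer_iff]
  exact forall₂_congr fun g _ => eq_comm

/-- The permutations that the search has to find. -/
def Target {m : ℕ} (gA gB : List (Perm (Fin m))) (l : Perm (Fin m)) : Prop :=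
  l ∈ commGroup gA ∧ Canon (commGroup gB) l

/-- The output item that belongs to a permutation. -/
def itemCode {m : ℕ} (gB : List (Perm (Fin m))) (l : Perm (Fin m)) : List ℕ :=
  gB.flatMap fun g => permCode (l⁻¹ * g * l)

/-- What holds throughout the search. -/
structure Env {m : ℕ} (V bA bB bF : ℕ) (gA gB : List (Perm (Fin m))) (s : St) : Prop where
  r0 : s.reg 0 = m
  r1 : s.reg 1 = gA.length
  r2 : s.reg 2 = gB.length
  r3 : s.reg 3 = bA
  r4 : s.reg 4 = bB
  r5 : s.reg 5 = bF
  r6 : s.reg 6 = bF + 1 + m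
  r14 : s.reg 14 = m * m
  tabA : Table gA bA s.mem
  tabB : Table gB bB s.mem
  leA : bA + gA.length * m ≤ bF
  leB : bB + gB.length * m ≤ bF
  zero : s.mem bF = 0
  leV : m + 2 ≤ V
  buf : s.buf = []

theorem Env.congr {m V bA bB bF : ℕ} {gA gB : List (Perm (Fin m))} {s s' : St}
    (h : Env V bA bB bF gA gB s) (hf : ∀ r ∉ bodyStm.writes, s'.reg r = s.reg r)
    (hm : ∀ a < bF + 1, s'.mem a = s.mem a) (hb : s'.buf = []) : Env V bA bB bF gA gB s' where
  r0 := (hf 0 (by decide)).trans h.r0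
  r1 := (hf 1 (by decide)).trans h.r1
  r2 := (hf 2 (by decide)).trans h.r2
  r3 := (hf 3 (by decide)).trans h.r3
  r4 := (hf 4 (by decide)).trans h.r4
  r5 := (hf 5 (by decide)).trans h.r5
  r6 := (hf 6 (by decide)).trans h.r6
  r14 := (hf 14 (by decide)).trans h.r14
  tabA := h.tabA.congr (h.leA.trans (Nat.le_succ _)) hm
  tabB := h.tabB.congr (h.leB.trans (Nat.le_succ _)) hm
  leA := h.leA
  leB := h.leB
  zero := (hm bF (Nat.lt_succ_self _)).trans h.zero
  leV := h.leV
  buf := hb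

/-- The first `k` values of the stored partial map are those of `l`. -/
def Stored {m : ℕ} (bF k : ℕ) (l : Perm (Fin m)) (s : St) : Prop :=
  ∀ i : Fin m, i.val < k → s.mem (bF + 1 + i) = l i

/-! ### One step of the search -/

section Body

variable {m V bA bB bF : ℕ} {gA gB : List (Perm (Fin m))} {s : St} {k : ℕ} {l : Perm (Fin m)}

/-- The cell `bF + k` is the one read on return to depth `k`. It holds the value at position `k -
1`, or for `k = 0` the sentinel zero in front of the partial map. -/
theorem Env.mem_le (h : Env V bA bB bF gA gB s) (hl : Stored bF k l s) (hk : k ≤ m) :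
    s.mem (bF + k) + 1 ≤ V := by
  have := h.leV
  cases k with
  | zero =>
    have := h.zero
    rw [← Nat.add_zero bF] at this
    omega
  | succ k =>
    have h1 := hl ⟨k, hk⟩ (Nat.lt_succ_self k)
    have h2 := (l ⟨k, hk⟩).2
    simp only at h1
    rw [show bF + (k + 1) = bF + 1 + k by omega]
    omega

theorem tri_backStm (h5 : s.reg 5 = bF) (h7 : s.reg 7 = k + 1) (hk : s.mem (bF + k) + 1 ≤ V) :
    Tri V backStm s (fun s' => s' = (s.set 7 k).set 8 (s.mem (bF + k) + 1)) := by
  refine Tri.of_bdd fun hs => ?_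
  have := hs.reg 7
  refine Tri.seq (Tri.set ?_ (Tri.set ?_ ?_))
  · simp only [Expr.val]
    omega
  · simpa [h5, h7] using hk
  · simp [h5, h7]

theorem tri_body_back (h : Env V bA bB bF gA gB s) (hl : Stored bF k l s) (hk : k < m)
    (h7 : s.reg 7 = k + 1) (h8 : s.reg 8 = m) :
    Tri V bodyStm s (fun s' => s'.reg 20 = 0 ∧ s'.reg 7 = k ∧ s'.reg 8 = s.mem (bF + k) + 1 ∧
      s'.mem = s.mem ∧ s'.buf = s.buf) := by
  refine Tri.seq (Tri.set (Nat.zero_le _) (Tri.ite (fun _ => Tri.ite (fun h' => ?_) fun _ => ?_)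
    fun h' => ?_))
  · simp [h.r0, h8] at h'
  · refine (tri_backStm (s := s.set 20 0) (bF := bF) (k := k) (by simpa using h.r5) (by simpa using h7)
      (h.mem_le hl hk.le)).imp ?_
    rintro s' - - rfl
    simp
  · simp [h.r0, h7] at h'
    omega

theorem tri_body_out (h : Env V bA bB bF gA gB s) (hl : Stored bF m l s)
    (h7 : s.reg 7 = m + 1) :
    Tri V bodyStm s (fun s' => s'.reg 20 ≠ 0 ∧ s'.reg 7 = m ∧ s'.reg 8 = s.mem (bF + m) + 1 ∧
      s'.mem = s.mem ∧ s'.buf = itemCode gB l) := by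
  have hV := h.leV
  refine Tri.seq (Tri.set (Nat.zero_le _) (Tri.ite (fun h' => ?_) fun _ => Tri.seq ?_))
  · simp [h.r0, h7] at h'
  · refine (tri_outStm (s := s.set 20 0) (l := l) (gB := gB) (by simpa using h.r0) (by simpa using h.r5)
      (fun i => hl i i.2) (by simpa using h.r4) (by simpa using h.r2) h.tabB).imp ?_
    rintro s₁ - hf₁ ⟨hm₁, hb₁⟩
    have f₁ : ∀ r, r ≠ 20 → r ∉ outStm.writes → s₁.reg r = s.reg r := fun r h1 h2 => by
      rw [hf₁ r h2, St.set_reg, if_neg h1]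
    refine Tri.seq (Tri.set (by simp only [Expr.val]; omega) ?_)
    have hm₁' : s₁.mem = s.mem := hm₁
    refine (tri_backStm (k := m) (bF := bF) ?_ ?_ ?_).imp ?_
    · simpa using (f₁ 5 (by decide) (by decide)).trans h.r5
    · simpa using (f₁ 7 (by decide) (by decide)).trans h7
    · simpa [hm₁'] using h.mem_le hl le_rfl
    · rintro s' - - rfl
      simp [hm₁', hb₁, h.buf, itemCode]

/-- The permutation `l` only witnesses that the current prefix belongs to some target. With it
`canon_step` makes the test exact: a child is entered iff a target lies below it. -/
theorem tri_body_try (h : Env V bA bB bF gA gB s) (hCD : commGroup gB ≤ commGroup gA)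
    {k y : Fin m} (ht : Target gA gB l)
    (hl : Stored bF k l s) (h7 : s.reg 7 = k + 1) (h8 : s.reg 8 = y) :
    Tri V bodyStm s (fun s' => s'.reg 20 = 0 ∧ s'.buf = s.buf ∧
      (∀ a < bF + 1 + k, s'.mem a = s.mem a) ∧
      ((∃ l', Target gA gB l' ∧ (∀ i < k, l' i = l i) ∧ l' k = y) ∧ s'.reg 7 = k + 2 ∧
          s'.reg 8 = 0 ∧ s'.mem (bF + 1 + k) = y ∨
        (¬ ∃ l', Target gA gB l' ∧ (∀ i < k, l' i = l i) ∧ l' k = y) ∧ s'.reg 7 = k + 1 ∧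
          s'.reg 8 = y + 1)) := by
  have hV := h.leV
  have hk := k.2
  have hy := y.2
  refine Tri.seq (Tri.set (Nat.zero_le _) (Tri.ite (fun _ => Tri.ite (fun _ => ?_) fun h' => ?_)
    fun h' => ?_))
  · refine Tri.seq (Tri.set (by simp [h7]; omega) (Tri.seq ?_))
    simp only [Expr.val]
    rw [show (s.set 20 0).reg 7 - 1 = k by simp [h7]]
    have hA := h.leA
    have hB := h.leB
    refine (tri_testStm (s := (s.set 20 0).set 22 k) (b := bF + 1 + m) (bF := bF) (bA := bA) (bB := bB) (gA := gA) (gB := gB)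
      (F := l) (k := k) (y := y) (by omega) (by simpa using h.r0) (by simpa using h.r6)
      (by simpa using h.r14) (by simpa using h.r5) le_rfl (by simp)
      (fun i hi => hl i hi) (by simpa using h8) (by simpa using h.r3) (by simpa using h.r1) h.tabA
      (by omega) (by simpa using h.r4) (by simpa using h.r2) h.tabB (by omega)).imp ?_
    rintro s₁ - hf₁ ⟨hm₁, hb₁, hiff⟩
    have hiff' : s₁.reg 9 ≠ 0 ↔
        ∃ l', Target gA gB l' ∧ (∀ i < k, l' i = l i) ∧ l' k = y := by
      have hstep := canon_step hCD (F := l) (k := k) ⟨l, ht.1, ht.2, fun _ _ => rfl⟩ y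
      simp only [mem_commGroup] at hstep
      rw [hiff, ← hstep]
      simp only [Target, mem_commGroup, and_assoc]
    have f₁ : ∀ r, r ≠ 20 → r ≠ 22 → r ∉ testStm.writes → s₁.reg r = s.reg r :=
      fun r h1 h2 h3 => by rw [hf₁ r h3]; simp [h1, h2]
    have g5 := (f₁ 5 (by decide) (by decide) (by decide)).trans h.r5
    have g7 := (f₁ 7 (by decide) (by decide) (by decide)).trans h7
    have g8 := (f₁ 8 (by decide) (by decide) (by decide)).trans h8
    have g20 : s₁.reg 20 = 0 := by rw [hf₁ 20 (by decide)]; simp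
    have hm : ∀ a < bF + 1 + k, s₁.mem a = s.mem a := fun a ha => hm₁ a (by omega)
    refine Tri.ite (fun h9 => Tri.seq (Tri.store ?_ (Tri.seq (Tri.set ?_ (Tri.set
      (Nat.zero_le _) ?_))))) (fun h9 => Tri.set ?_ ?_)
    · simp only [Expr.val]
      omega
    · simp only [Expr.val, St.put_reg]
      omega
    · refine ⟨by simpa using g20, hb₁, fun a ha => ?_, Or.inl ⟨hiff'.1 h9, by simp [g7],
        by simp, ?_⟩⟩
      · simp only [Expr.val, St.set_mem, St.put_mem, g5, g7]
        rw [if_neg (by omega)]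
        exact hm a ha
      · simp [g5, g7, g8, Nat.add_comm, Nat.add_left_comm]
    · simp only [Expr.val]
      omega
    · refine ⟨by simpa using g20, hb₁, hm, Or.inr ⟨fun hex => hiff'.2 hex h9, ?_, ?_⟩⟩
      · simpa using g7
      · simp [g8]
  · simp [h.r0, h8] at h'
    omega
  · simp [h.r0, h7] at h'
    omega

end Body

/-! ### Delays -/

/-- The next event, if it comes within time `w`, respects the delay `D`. -/
def Paced (D w : ℕ) (c : Config) : Prop :=
  ∀ t ≤ c.clock + w, List.IsChain (fun t₁ t₂ : ℕ => t₂ ≤ t₁ + D)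
    (0 :: (c.out.map Prod.snd ++ [t]))

theorem Paced.mono {D w w' : ℕ} {c : Config} (h : Paced D w c) (hw : w' ≤ w) : Paced D w' c :=
  fun t ht => h t (by omega)

theorem Paced.pass {D w T : ℕ} {c c' : Config} (h : Paced D w c) (ho : c'.out = c.out)
    (hc : c'.clock ≤ c.clock + T) (hT : T ≤ w) : Paced D (w - T) c' := by
  intro t ht
  rw [ho]
  exact h t (by omega)

/-- A delivery renews the budget to `D`, but up to `T` of the step may fall after the delivery, so
`D - T` is what is surely left. -/
theorem Paced.output {D w T t : ℕ} {c c' : Config} {x : List ℕ} (h : Paced D w c)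
    (ho : c'.out = c.out ++ [(x, t)]) (h1 : c.clock ≤ t) (h2 : t ≤ c'.clock)
    (hc : c'.clock ≤ c.clock + T) (hT : T ≤ w) (hD : T ≤ D) : Paced D (D - T) c' := by
  intro t' ht'
  have h3 := h t (by omega)
  rw [ho, List.map_append, List.append_assoc]
  change List.IsChain _ ((0 :: c.out.map Prod.snd) ++ t :: [t'])
  rw [List.isChain_split]
  refine ⟨h3, ?_⟩
  simp only [List.isChain_pair]
  omega

/-- Delivery stays outside `Stm`, whose triples leave the output alone. Beyond the body a round
costs at most two register tests and one delivery, hence `2 * V + 3`. The execution is stated as a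
way to prolong any later run backwards, so that rounds can be glued before the end of the loop is
known. -/
theorem search_step {V : ℕ} {c : Config} {s : St} {Q : St → Prop} (hc : Rel c s) (hs : s.Bdd V)
    (h7 : s.reg 7 ≠ 0) (h : Tri V bodyStm s Q) :
    ∃ c' s' t, (∀ c'', Exec searchLoop c' c'' → Exec searchLoop c c'') ∧ s'.Bdd V ∧
      c.clock ≤ t ∧ t ≤ c'.clock ∧ c'.clock ≤ c.clock + (bodyStm.time V + (2 * V + 3)) ∧
      (∀ r ∉ bodyStm.writes, s'.reg r = s.reg r) ∧ Q s' ∧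
      (s'.reg 20 = 0 → Rel c' s' ∧ c'.out = c.out) ∧
      (s'.reg 20 ≠ 0 → Rel c' { s' with buf := [] } ∧ c'.out = c.out ++ [(s'.buf, t)]) := by
  obtain ⟨c₁, s₁, e₁, r₁, b₁, o₁, l₁, t₁, f₁, q₁⟩ :=
    h hs _ (hc.tick (1 + (c.reg (2 * 7)).size))
  have z1 := size_le_self (c.reg (2 * 7))
  have z2 := size_le_self (c₁.reg (2 * 20))
  have z3 := hs.reg 7
  have z4 := b₁.reg 20
  rw [hc.reg] at z1
  rw [r₁.reg] at z2
  simp only [Config.tick, hc.reg] at l₁ t₁ o₁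
  have h7' : c.reg (2 * 7) ≠ 0 := by rwa [hc.reg]
  by_cases h20 : s₁.reg 20 = 0
  · have h20' : c₁.reg (2 * 20) = 0 := by rwa [r₁.reg]
    refine ⟨c₁.tick 1, s₁, c.clock, fun c'' h'' => .loop_again h7'
      (.seq e₁ (.branch_false h20' (.skip _))) h'', b₁, le_rfl, ?_, ?_, f₁, q₁,
      fun _ => ⟨r₁.tick 1, o₁⟩, fun h => absurd h20 h⟩ <;> simp only [Config.tick] <;> omega
  · have h20' : c₁.reg (2 * 20) ≠ 0 := by rwa [r₁.reg]
    refine ⟨_, s₁, c₁.clock + (1 + (s₁.reg 20).size) + 1, fun c'' h'' => .loop_again h7'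
      (.seq e₁ (.branch_true h20' (.instr _ _))) h'', b₁, by omega, ?_, ?_, f₁, q₁,
      fun h => absurd h h20, fun _ => ⟨⟨r₁.reg, r₁.mem, rfl⟩, ?_⟩⟩
    · simp only [Instr.effect, Instr.cost, Config.tick, r₁.reg]
      omega
    · simp only [Instr.effect, Instr.cost, Config.tick, r₁.reg]
      omega
    · have h40 : c₁.reg 40 = s₁.reg 20 := r₁.reg 20
      simp [Instr.effect, Instr.cost, Config.tick, h40, r₁.buf, o₁]

/-! ### The search -/

/-- The search, started in `c` and `s`, comes to `c'` and `s'` and has then left the subtree of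
depth `k` after delivering the items of exactly the permutations with the property `P`; the budget
until the next event is then `w`. -/
structure Leaves {m : ℕ} (V bA bB bF : ℕ) (gA gB : List (Perm (Fin m))) (D w k : ℕ)
    (P : Perm (Fin m) → Prop) (c : Config) (s : St) (c' : Config) (s' : St)
    (L : List (Perm (Fin m))) : Prop where
  exec : ∀ c'', Exec searchLoop c' c'' → Exec searchLoop c c''
  rel : Rel c' s'
  bdd : s'.Bdd V
  env : Env V bA bB bF gA gB s'
  r7 : s'.reg 7 = k
  r8 : s'.reg 8 = s.mem (bF + k) + 1
  mem : ∀ a < bF + 1 + k, s'.mem a = s.mem a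
  paced : Paced D w c'
  nodup : L.Nodup
  mem_iff : ∀ l, l ∈ L ↔ P l
  out : c'.out.map Prod.fst = c.out.map Prod.fst ++ L.map (itemCode gB)

section Search

variable {m V bA bB bF : ℕ} {gA gB : List (Perm (Fin m))} {D T : ℕ}

/-- The search of a subtree whose root has depth `k`, at most `d` levels above the leaves. -/
def SearchSpec (V bA bB bF : ℕ) (gA gB : List (Perm (Fin m))) (D A d : ℕ) : Prop :=
  ∀ k, k + d = m → ∀ c s l w, Rel c s → s.Bdd V → Env V bA bB bF gA gB s → s.reg 7 = k + 1 →
    s.reg 8 = 0 → Target gA gB l → Stored bF k l s → Paced D w c → A ≤ w →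
    ∃ c' s' L, Leaves V bA bB bF gA gB D (D - A) k
      (fun l' => Target gA gB l' ∧ ∀ i : Fin m, i.val < k → l' i = l i) c s c' s' L

/-- At a leaf all `m` values are fixed, so exactly one permutation remains, and a single step
delivers its item and backs up. -/
theorem searchSpec_zero (hT : T = bodyStm.time V + (2 * V + 3)) (hD : T ≤ D) :
    SearchSpec V bA bB bF gA gB D T 0 := by
  rintro k hkm c s l w hc hs henv h7 h8 ht hl hp hw
  obtain rfl : m = k := hkm.symm
  obtain ⟨c', s', t, he, hb', h1, h2, h3, hf, ⟨q1, q2, q3, q4, q5⟩, -, hout⟩ :=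
    search_step hc hs (by omega) (tri_body_out henv hl h7)
  obtain ⟨hrel, ho⟩ := hout q1
  refine ⟨c', _, [l], he, hrel, ⟨hb'.reg, hb'.mem⟩,
    henv.congr hf (fun a _ => congrFun q4 a) rfl, q2, q3, fun a _ => congrFun q4 a,
    hp.output ho h1 h2 (hT ▸ h3) hw hD, by simp, fun l' => ?_, ?_⟩
  · rw [List.mem_singleton]
    constructor
    · rintro rfl
      exact ⟨ht, fun _ _ => rfl⟩
    · exact fun h => Equiv.ext fun i => h.2 i i.2
  · simp [ho, q5]

/-- Recursion on the number `r` of values left to try. The budget always covers the remaining steps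
and the wait `A` inside one child. The disjunction records why the promised budget will be there at
the end: either a target is still to come, and the visit to its child will renew the budget, or the
present budget already exceeds the promise by the cost of the remaining steps. -/
theorem search_values (hT : T = bodyStm.time V + (2 * V + 3)) {A d : ℕ}
    (hD : 2 * A + 2 * ((m + 1) * T) ≤ D)
    (hCD : commGroup gB ≤ commGroup gA) (ih : SearchSpec V bA bB bF gA gB D A d) (k : Fin m)
    (hkd : k + (d + 1) = m) :
    ∀ r y, y + r = m → ∀ c s l w, Rel c s → s.Bdd V → Env V bA bB bF gA gB s →
      s.reg 7 = k + 1 → s.reg 8 = y → Target gA gB l → Stored bF k l s → Paced D w c →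
      (r + 1) * T + A ≤ w →
      ((∃ l', Target gA gB l' ∧ (∀ i < k, l' i = l i) ∧ y ≤ (l' k).val) ∨
        D - (A + (m + 1) * T) + (r + 1) * T ≤ w) →
      ∃ c' s' L, Leaves V bA bB bF gA gB D (D - (A + (m + 1) * T)) k
        (fun l' => Target gA gB l' ∧ (∀ i < k, l' i = l i) ∧ y ≤ (l' k).val) c s c' s' L := by
  intro r
  induction r with
  | zero =>
    rintro y hym c s l w hc hs henv h7 h8 ht hl hp hw hor
    obtain rfl : m = y := hym.symm
    obtain ⟨c', s', t, he, hb', h1, h2, h3, hf, ⟨q1, q2, q3, q4, q5⟩, hpass, -⟩ :=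
      search_step hc hs (by omega) (tri_body_back henv hl k.2 h7 h8)
    obtain ⟨hrel, ho⟩ := hpass q1
    have hnone : ∀ l' : Perm (Fin m), ¬ m ≤ (l' k).val := fun l' => (l' k).2.not_ge
    -- No value reaches `m`, so nothing is still to come and the second alternative must hold.
    have hw' := hor.resolve_left (by rintro ⟨l', -, -, h⟩; exact hnone l' h)
    refine ⟨c', s', [], he, hrel, hb', henv.congr hf (fun a _ => congrFun q4 a)
      (q5.trans henv.buf), q2, q3, fun a _ => congrFun q4 a,
      (hp.pass ho (hT ▸ h3) (by omega)).mono (by omega), List.nodup_nil, fun l' => ?_, ?_⟩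
    · simp only [List.not_mem_nil, false_iff]
      exact fun h => hnone l' h.2.2
    · simp [ho]
  | succ r ihr =>
    rintro y hym c s l w hc hs henv h7 h8 ht hl hp hw hor
    have hy : y < m := by omega
    have e1 : (r + 1 + 1) * T = (r + 1) * T + T := by ring
    have e2 : (r + 1) * T ≤ (m + 1) * T := Nat.mul_le_mul_right _ (by omega)
    rw [e1] at hw hor
    obtain ⟨c₁, s₁, t, he, hb₁, h1, h2, h3, hf, ⟨q1, q2, q3, q4⟩, hpass, -⟩ :=
      search_step hc hs (by omega) (tri_body_try (y := ⟨y, hy⟩) henv hCD ht hl h7 h8)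
    obtain ⟨hrel, ho⟩ := hpass q1
    have henv₁ : Env V bA bB bF gA gB s₁ :=
      henv.congr hf (fun a ha => q3 a (by omega)) (q2.trans henv.buf)
    have hl₁ : Stored bF k l s₁ := fun i hi => by rw [q3 _ (by omega), hl i hi]
    have hp₁ : Paced D (w - T) c₁ := hp.pass ho (hT ▸ h3) (by omega)
    rcases q4 with ⟨⟨l', ht', hagree, hlk⟩, p7, p8, pm⟩ | ⟨hno, p7, p8⟩
    · have hl'₁ : Stored bF (k + 1) l' s₁ := by
        intro i hi
        rcases Nat.lt_succ_iff_lt_or_eq.1 hi with hi | hi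
        · rw [hagree i hi]
          exact hl₁ i hi
        · obtain rfl : i = k := Fin.ext hi
          rw [pm, hlk]
      obtain ⟨c₂, s₂, L, hL⟩ := ih (k + 1) (by omega) c₁ s₁ l' (w - T) hrel hb₁ henv₁
        (by omega) p8 ht' hl'₁ hp₁ (by omega)
      -- Backing up from the child reloads the stored value at position `k`, which is `y`, and goes
      -- one further.
      have r8 : s₂.reg 8 = y + 1 := by
        rw [hL.r8, show bF + (k.val + 1) = bF + 1 + k by omega, pm]
      have hl₂ : Stored bF k l s₂ := fun i hi => by
        rw [hL.mem _ (by omega)]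
        exact hl₁ i hi
      obtain ⟨c₃, s₃, L', hL'⟩ := ihr (y + 1) (by omega) c₂ s₂ l (D - A) hL.rel hL.bdd hL.env
        hL.r7 r8 ht hl₂ hL.paced (by omega) (Or.inr (by omega))
      refine ⟨c₃, s₃, L ++ L', fun c'' h'' => he _ (hL.exec _ (hL'.exec _ h'')), hL'.rel, hL'.bdd,
        hL'.env, hL'.r7, ?_, fun a ha => ?_, hL'.paced, ?_, fun l'' => ?_, ?_⟩
      · rw [hL'.r8, hL.mem _ (by omega), q3 _ (by omega)]
      · rw [hL'.mem a ha, hL.mem a (by omega), q3 a ha]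
      · refine List.Nodup.append hL.nodup hL'.nodup fun l'' hm hm' => ?_
        have g1 := ((hL.mem_iff l'').1 hm).2 k (Nat.lt_succ_self _)
        have g2 := ((hL'.mem_iff l'').1 hm').2.2
        rw [g1, hlk] at g2
        simp at g2
      · rw [List.mem_append, hL.mem_iff, hL'.mem_iff]
        constructor
        · rintro (⟨g1, g2⟩ | ⟨g1, g2, g3⟩)
          · refine ⟨g1, fun i hi => ?_, ?_⟩
            · rw [g2 i (Nat.lt_succ_of_lt hi), hagree i hi]
            · rw [g2 k (Nat.lt_succ_self _), hlk]
          · exact ⟨g1, g2, by omega⟩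
        · rintro ⟨g1, g2, g3⟩
          rcases Nat.eq_or_lt_of_le g3 with g4 | g4
          · refine Or.inl ⟨g1, fun i hi => ?_⟩
            rcases Nat.lt_succ_iff_lt_or_eq.1 hi with hi | hi
            · rw [g2 i hi, hagree i hi]
            · obtain rfl : i = k := Fin.ext hi
              rw [hlk]
              exact Fin.ext g4.symm
          · exact Or.inr ⟨g1, g2, g4⟩
      · rw [hL'.out, hL.out, ho]
        simp
    -- A rejected `y` is the value of no target with this prefix, so skipping it loses nothing.
    · have hne : ∀ l', Target gA gB l' ∧ (∀ i < k, l' i = l i) ∧ y ≤ (l' k).val ↔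
          Target gA gB l' ∧ (∀ i < k, l' i = l i) ∧ y + 1 ≤ (l' k).val := by
        intro l'
        refine and_congr_right fun g1 => and_congr_right fun g2 => ⟨fun g3 => ?_, by omega⟩
        exact lt_of_le_of_ne g3 fun heq => hno ⟨l', g1, g2, Fin.ext heq.symm⟩
      simp only [hne] at hor ⊢
      obtain ⟨c₃, s₃, L', hL'⟩ := ihr (y + 1) (by omega) c₁ s₁ l (w - T) hrel hb₁ henv₁ p7 p8
        ht hl₁ hp₁ (by omega) (hor.imp id fun h => by omega)
      refine ⟨c₃, s₃, L', fun c'' h'' => he _ (hL'.exec _ h''), hL'.rel, hL'.bdd,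
        hL'.env, hL'.r7, ?_, fun a ha => ?_, hL'.paced, hL'.nodup, hL'.mem_iff, ?_⟩
      · rw [hL'.r8, q3 _ (by omega)]
      · rw [hL'.mem a ha, q3 a ha]
      · rw [hL'.out, ho]

/-- Each level adds at most `m` trials and one return, that is `(m + 1) * T`, to the time before the
first and after the last output. The delay `D` has room for the end of one subtree, the steps
between, and the start of the next. -/
theorem searchSpec (hT : T = bodyStm.time V + (2 * V + 3)) (hCD : commGroup gB ≤ commGroup gA)
    (hD : 2 * (T + m * ((m + 1) * T)) + 2 * ((m + 1) * T) ≤ D) :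
    ∀ d ≤ m, SearchSpec V bA bB bF gA gB D (T + d * ((m + 1) * T)) d := by
  intro d
  induction d with
  | zero =>
    intro _
    rw [Nat.zero_mul, Nat.add_zero]
    exact searchSpec_zero hT (by omega)
  | succ d ih =>
    intro hd k hkd c s l w hc hs henv h7 h8 ht hl hp hw
    have e1 : (d + 1) * ((m + 1) * T) = d * ((m + 1) * T) + (m + 1) * T := by ring
    have e2 : d * ((m + 1) * T) ≤ m * ((m + 1) * T) := Nat.mul_le_mul_right _ (by omega)
    -- The target `l` itself shows that the subtree is not empty, so the first alternative holds at
    -- `y = 0`.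
    obtain ⟨c', s', L, hL⟩ := search_values hT (by omega) hCD (ih (by omega)) ⟨k, by omega⟩ hkd
      m 0 (by omega) c s l w hc hs henv h7 h8 ht hl hp (by omega)
      (Or.inl ⟨l, ht, fun _ _ => rfl, Nat.zero_le _⟩)
    refine ⟨c', s', L, hL.exec, hL.rel, hL.bdd, hL.env, hL.r7, hL.r8, hL.mem, ?_, hL.nodup,
      fun l' => ?_, hL.out⟩
    · rw [e1, ← Nat.add_assoc]
      exact hL.paced
    · rw [hL.mem_iff]
      simp [Fin.lt_def]

end Search

/-! ### Setup and input -/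

/-- The layout is: four header cells, generators and images for M, generators and images for G, a
sentinel, the partial map of length `m`, the matrix. Registers `3` and `4` point at the two blocks
of images; the generators themselves are never consulted. -/
theorem tri_setupStm {V n m a b : ℕ} {s : St} (h0 : s.mem 0 = n) (h1 : s.mem 1 = m)
    (h2 : s.mem 2 = a) (h3 : s.mem 3 = b)
    (hV : 4 + a * n + (a * m + b * n) + b * m + 1 + m ≤ V) (hm : m * m ≤ V) :
    Tri V setupStm s (fun s' => s'.mem = s.mem ∧ s'.buf = s.buf ∧ s'.reg 0 = m ∧ s'.reg 1 = a ∧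
      s'.reg 2 = b ∧ s'.reg 3 = 4 + a * n ∧ s'.reg 4 = 4 + a * n + (a * m + b * n) ∧
      s'.reg 5 = 4 + a * n + (a * m + b * n) + b * m ∧
      s'.reg 6 = 4 + a * n + (a * m + b * n) + b * m + 1 + m ∧ s'.reg 14 = m * m ∧
      s'.reg 7 = 1 ∧ s'.reg 8 = 0) := by
  refine Tri.of_bdd fun hs => ?_
  refine Tri.seq (Tri.set (hs.mem _) (Tri.seq (Tri.set (hs.mem _) (Tri.seq (Tri.set (hs.mem _)
    (Tri.seq (Tri.set (hs.mem _) (Tri.seq (Tri.set ?_ (Tri.seq (Tri.set ?_ (Tri.seq (Tri.set ?_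
      (Tri.seq (Tri.set ?_ (Tri.seq (Tri.set ?_ (Tri.seq (Tri.set ?_ (Tri.set ?_
        ?_))))))))))))))))))))
  all_goals simp [h0, h1, h2, h3]
  all_goals omega

theorem length_flatMap_permCode {m : ℕ} (gs : List (Perm (Fin m))) :
    (gs.flatMap permCode).length = gs.length * m := by
  induction gs with
  | nil => simp
  | cons g gs ih =>
    rw [List.flatMap_cons, List.length_append, ih, List.length_cons]
    simp [permCode]
    ring

theorem table_of_eq_append {m : ℕ} {gs : List (Perm (Fin m))} {p : ℕ} {X P R : List ℕ}
    (hX : X = P ++ (gs.flatMap permCode ++ R)) (hp : P.length = p) :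
    Table gs p (fun i => X.getD i 0) := by
  subst hX hp
  induction gs generalizing P with
  | nil => exact fun a ha => absurd ha (Nat.not_lt_zero _)
  | cons g gs ih =>
    rintro (_ | a) ha u
    · have hu : (u : ℕ) < (permCode g).length := by simp [permCode]
      simp only [Nat.zero_mul, Nat.zero_add, List.flatMap_cons, List.append_assoc]
      rw [List.getD_append_right _ _ _ _ (by omega), Nat.add_sub_cancel_left,
        List.getD_append _ _ _ _ hu, List.getD_eq_getElem _ _ hu]
      simp [permCode]
    · have := ih (P := P ++ permCode g) a (by simpa using ha) u
      have hlen : (permCode g).length = m := by simp [permCode]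
      simp only [List.append_assoc, List.length_append, hlen] at this
      simp only [List.flatMap_cons, List.append_assoc, List.getElem_cons_succ]
      rw [← this]
      congr 1
      ring

theorem groupCode_eq {n : ℕ} {G : Subgroup (Perm (Fin n))} (B : List G) :
    groupCode B = (B.map Subtype.val).flatMap permCode := by
  rw [groupCode, List.map_eq_flatMap]
  rfl

theorem homCode_eq {n m : ℕ} {G : Subgroup (Perm (Fin n))} (B : List G) (φ : G →* Perm (Fin m)) :
    homCode B φ = (B.map φ).flatMap permCode := by
  rw [homCode, List.flatMap_map]

theorem le_of_mem_flatMap_permCode {m x : ℕ} {gs : List (Perm (Fin m))}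
    (hx : x ∈ gs.flatMap permCode) : x ≤ m := by
  obtain ⟨g, -, hx⟩ := List.mem_flatMap.1 hx
  rw [permCode, List.mem_ofFn] at hx
  obtain ⟨i, rfl⟩ := hx
  exact (g i).2.le

/-- A bound for all the numbers that occur. -/
def valueBound (N : ℕ) : ℕ := 10 * (N * N) + 10

/-- A bound for the running time of one step of the search. -/
def stepTime (N : ℕ) : ℕ := bodyStm.time (valueBound N) + (2 * valueBound N + 3)

/-- A bound for the delay. -/
def delay (N : ℕ) : ℕ :=
  setupStm.time (valueBound N) + (2 * (stepTime N + N * ((N + 1) * stepTime N)) +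
    2 * ((N + 1) * stepTime N))

theorem polyBdd_delay : PolyBdd delay := by
  have hN := PolyBdd.id
  have h1 := PolyBdd.const 1
  have h2 := PolyBdd.const 2
  have hV : PolyBdd valueBound := ((PolyBdd.const 10).mul (hN.mul hN)).add (.const 10)
  have hT : PolyBdd stepTime :=
    (bodyStm.polyBdd_time hV).add ((h2.mul hV).add (.const 3))
  have hU := (hN.add h1).mul hT
  exact (setupStm.polyBdd_time hV).add ((h2.mul (hT.add (hN.mul hU))).add (h2.mul hU))

theorem enumerates {n m : ℕ} {M G : Subgroup (Perm (Fin n))} (h : M ≤ G)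
    (ψ : M →* Perm (Fin m)) (φ : G →* Perm (Fin m)) (A : List M) (B : List G)
    (hA : IsGenList A) (hB : IsGenList B) (hφ : Extends h ψ φ) :
    ∃ E : List (G →* Perm (Fin m)), E.Nodup ∧
      (∀ χ, χ ∈ E ↔ EquivalentExtensions h ψ χ φ) ∧
      EnumeratesAtMarginalCost enumProg (inputCode A B ψ φ) (E.map (homCode B))
        (delay (n + m + 1)) := by
  set N := n + m + 1 with hN
  set V := valueBound N with hV
  set T := stepTime N with hT
  set D := delay N with hD
  set gA := A.map ψ with hgA
  set gB := B.map φ with hgB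
  have hDA : Subgroup.centralizer (ψ.range : Set (Perm (Fin m))) = commGroup gA := by
    ext c
    rw [mem_centralizer_iff_gens ψ hA.1, mem_commGroup]
  have hCB : Subgroup.centralizer (φ.range : Set (Perm (Fin m))) = commGroup gB := by
    ext c
    rw [mem_centralizer_iff_gens φ hB.1, mem_commGroup]
  have hCD : commGroup gB ≤ commGroup gA := hDA ▸ hCB ▸ centralizer_le hφ
  set X := inputCode A B ψ φ with hX
  have lA : A.length ≤ 2 * n := hA.2
  have lB : B.length ≤ 2 * n := hB.2
  have lgA : gA.length = A.length := List.length_map _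
  have lgB : gB.length = B.length := List.length_map _
  have hX' : X = [n, m, A.length, B.length] ++
      ((A.map Subtype.val).flatMap permCode ++ (gA.flatMap permCode ++
        ((B.map Subtype.val).flatMap permCode ++ gB.flatMap permCode))) := by
    rw [hX, inputCode, groupCode_eq, groupCode_eq, homCode_eq, homCode_eq]
    simp only [List.append_assoc]
    rfl
  set s₀ : St := ⟨fun _ => 0, fun i => X.getD i 0, []⟩ with hs₀
  have hrel₀ : Rel (Config.init X) s₀ := ⟨fun _ => rfl, rfl, rfl⟩
  have hnV : 2 * n ≤ V ∧ m + 2 ≤ V := by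
    rw [hV, valueBound]
    constructor <;> nlinarith
  have hbdd₀ : s₀.Bdd V := by
    refine ⟨fun _ => Nat.zero_le _, fun i => ?_⟩
    have hall : ∀ x ∈ X, x ≤ V := by
      intro x hx
      rw [hX'] at hx
      simp only [List.mem_append] at hx
      rcases hx with hx | hx | hx | hx | hx
      · simp only [List.mem_cons, List.not_mem_nil, or_false] at hx
        omega
      all_goals
        have := le_of_mem_flatMap_permCode hx
        omega
    change X.getD i 0 ≤ V
    rcases lt_or_ge i X.length with hi | hi
    · rw [List.getD_eq_getElem _ _ hi]
      exact hall _ (List.getElem_mem hi)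
    · rw [List.getD_eq_default _ _ hi]
      exact Nat.zero_le _
  -- At most `2 * n` generators in each list keep all stored addresses quadratic in `N`;
  -- `valueBound` is chosen with this in view.
  have hsum : 4 + A.length * n + (A.length * m + B.length * n) + B.length * m + 1 + m ≤ V := by
    rw [hV, valueBound, hN]
    have h1 := Nat.mul_le_mul_right n lA
    have h2 := Nat.mul_le_mul_right m lA
    have h3 := Nat.mul_le_mul_right n lB
    have h4 := Nat.mul_le_mul_right m lB
    nlinarith
  have hmm : m * m ≤ V := by
    rw [hV, valueBound, hN]
    nlinarith
  set bF := 4 + A.length * n + (A.length * m + B.length * n) + B.length * m with hbF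
  obtain ⟨c₁, s₁, e₁, r₁, b₁, o₁, -, t₁, -, hm, hbuf, g0, g1, g2, g3, g4, g5, g6, g14, g7, g8⟩ :=
    tri_setupStm (s := s₀) (V := V) (n := n) (m := m) (a := A.length) (b := B.length)
      (by rw [hs₀, hX']; rfl) (by rw [hs₀, hX']; rfl) (by rw [hs₀, hX']; rfl)
      (by rw [hs₀, hX']; rfl) hsum hmm hbdd₀ _ hrel₀
  have henv : Env V (4 + A.length * n) (4 + A.length * n + (A.length * m + B.length * n)) bF
      gA gB s₁ := by
    refine ⟨g0, g1.trans lgA.symm, g2.trans lgB.symm, g3, g4, g5, g6, g14, ?_, ?_, ?_, ?_, ?_,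
      hnV.2, hbuf⟩
    · rw [hm]
      refine table_of_eq_append (hX'.trans ?_) (P := [n, m, A.length, B.length] ++
        (A.map Subtype.val).flatMap permCode)
        (R := (B.map Subtype.val).flatMap permCode ++ gB.flatMap permCode) ?_
      · simp only [List.append_assoc]
      · rw [List.length_append, length_flatMap_permCode, List.length_map]
        rfl
    · rw [hm]
      refine table_of_eq_append (hX'.trans ?_) (P := [n, m, A.length, B.length] ++
        ((A.map Subtype.val).flatMap permCode ++ (gA.flatMap permCode ++
        (B.map Subtype.val).flatMap permCode))) (R := []) ?_
      · simp only [List.append_assoc, List.append_nil]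
      · simp only [List.length_append, length_flatMap_permCode, List.length_map, lgA,
          List.length_cons, List.length_nil]
        omega
    · rw [lgA]
      omega
    · rw [lgB]
    -- The first cell behind the input has the default content zero and serves as the sentinel.
    · rw [hm]
      refine List.getD_eq_default _ _ ?_
      rw [hX']
      simp only [List.length_append, length_flatMap_permCode, List.length_map, lgA, lgB,
        List.length_cons, List.length_nil]
      omega
  -- The canonical element of the trivial coset is a target, so the root of the search has an output
  -- below it.
  obtain ⟨l, hl, hcan⟩ := exists_canon (commGroup gB) (1 : Perm (Fin m))
  rw [mul_one] at hcan
  have hU : (m + 1) * T ≤ (N + 1) * T := Nat.mul_le_mul_right _ (by omega)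
  have hmU : m * ((m + 1) * T) ≤ N * ((N + 1) * T) := Nat.mul_le_mul (by omega) hU
  have hDe : D = setupStm.time V + (2 * (T + N * ((N + 1) * T)) + 2 * ((N + 1) * T)) := rfl
  have hTe : T = bodyStm.time V + (2 * V + 3) := rfl
  have t₁' : c₁.clock ≤ 0 + setupStm.time V := t₁
  -- The start counts as an event at time 0, and the setup has used up its share of the first delay.
  obtain ⟨c₂, s₂, L, hL⟩ := searchSpec (D := D) hTe hCD (by omega) m le_rfl 0 (by omega) c₁ s₁ l
    (D - setupStm.time V) r₁ b₁ henv g7 g8 ⟨hCD hl, hcan⟩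
    (fun i hi => absurd hi (Nat.not_lt_zero _)) (by
      intro t ht
      rw [o₁]
      simp only [Config.init, List.map_nil, List.nil_append, List.isChain_pair]
      omega) (by omega)
  obtain ⟨hnd, hmem⟩ := nodup_and_mem_of_canon hφ hL.nodup fun l' => by
    rw [hL.mem_iff, hDA, hCB]
    simp [Target]
  -- Depth is stored plus one, so leaving the root puts zero into register `7` and ends the loop.
  -- The last test costs one unit, which the budget left over covers.
  refine ⟨L.map (conjAction φ), hnd, hmem, c₂.tick 1,
    .seq e₁ (hL.exec _ (.loop_done ((hL.rel.reg 7).trans hL.r7))), ?_,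
    hL.rel.buf.trans hL.env.buf, hL.paced _ (Nat.add_le_add_left (by omega) _)⟩
  change c₂.out.map Prod.fst = _
  rw [hL.out, o₁, List.map_map]
  refine List.map_congr_left fun l' _ => ?_
  rw [itemCode, hgB, List.flatMap_map]
  rfl

theorem EnumeratesAtMarginalCost.mono {P : Prog} {input : List ℕ} {items : List (List ℕ)}
    {t t' : ℕ} (h : EnumeratesAtMarginalCost P input items t) (ht : t ≤ t') :
    EnumeratesAtMarginalCost P input items t' := by
  obtain ⟨s, h1, h2, h3, h4⟩ := h
  exact ⟨s, h1, h2, h3, h4.imp fun a b hab => by omega⟩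

end HomExtEnum

theorem mainTheorem11 :
    -- the class is the set of conjugates by the centralizer of `ψ(M)`, and its size is the index
    (∀ (n m : ℕ) (M G : Subgroup (Equiv.Perm (Fin n))) (h : M ≤ G)
        (ψ : M →* Equiv.Perm (Fin m)) (φ : G →* Equiv.Perm (Fin m)),
        HomExtEnum.Extends h ψ φ →
          (∀ χ : G →* Equiv.Perm (Fin m),
            HomExtEnum.EquivalentExtensions h ψ χ φ ↔
              ∃ c ∈ Subgroup.centralizer (ψ.range : Set (Equiv.Perm (Fin m))),
                χ = HomExtEnum.conjAction φ c) ∧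
          Subgroup.centralizer (φ.range : Set (Equiv.Perm (Fin m))) ≤
            Subgroup.centralizer (ψ.range : Set (Equiv.Perm (Fin m))) ∧
          Nat.card {χ : G →* Equiv.Perm (Fin m) // HomExtEnum.EquivalentExtensions h ψ χ φ} =
            (Subgroup.centralizer (φ.range : Set (Equiv.Perm (Fin m)))).relIndex
              (Subgroup.centralizer (ψ.range : Set (Equiv.Perm (Fin m))))) ∧
    -- one program enumerates every such class, at marginal cost polynomial in `n` and `m`
    (∃ (P : HomExtEnum.Prog) (a d : ℕ),
      ∀ (n m : ℕ) (M G : Subgroup (Equiv.Perm (Fin n))) (h : M ≤ G)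
        (ψ : M →* Equiv.Perm (Fin m)) (φ : G →* Equiv.Perm (Fin m)) (A : List M) (B : List G),
        HomExtEnum.IsGenList A → HomExtEnum.IsGenList B → HomExtEnum.Extends h ψ φ →
          ∃ E : List (G →* Equiv.Perm (Fin m)),
            E.Nodup ∧
            (∀ χ : G →* Equiv.Perm (Fin m),
              χ ∈ E ↔ HomExtEnum.EquivalentExtensions h ψ χ φ) ∧
            HomExtEnum.EnumeratesAtMarginalCost P (HomExtEnum.inputCode A B ψ φ)
              (E.map (HomExtEnum.homCode B)) (a * (n + m + 1) ^ d)) := by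
  refine ⟨fun n m M G h ψ φ hφ => ⟨HomExtEnum.equivalentExtensions_iff hφ,
    HomExtEnum.centralizer_le hφ, HomExtEnum.card_equivalentExtensions hφ⟩, ?_⟩
  obtain ⟨a, d, had⟩ := HomExtEnum.polyBdd_delay
  refine ⟨HomExtEnum.enumProg, a, d, fun n m M G h ψ φ A B hA hB hφ => ?_⟩
  obtain ⟨E, hnd, hmem, hE⟩ := HomExtEnum.enumerates h ψ φ A B hA hB hφ
  exact ⟨E, hnd, hmem, hE.mono (had _ (Nat.succ_le_succ (Nat.zero_le _)))⟩
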